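/- Consider an $M/GI/1/n$ queue: Poisson arrivals of rate $\lambda>0$, i.i.d. service times independent of the arrivals with distribution function $B$, $B(0)=0$, one server, and a buffer of size $n\ge 0$ excluding the customer in service. Let $L_n$ be the number of customers lost during a busy period (which starts with an arrival at the empty system). Let $E_\mu(x)=1-e^{-\mu x}$, $x\ge0$, with $\mu>0$. For distribution functions of nonnegative random variables write $\Xi_1\le_{\mathscr C_\lambda}\Xi_2$ if $$\int_0^\infty e^{-\lambda x}x^i\,\Xi_1(x)\,dx\ \ge\ \int_0^\infty e^{-\lambda x}x^i\,\Xi_2(x)\,dx\qquad\text{for all } i=0,1,2,\dots$$ Assume the following two conditions. (A) $B(x)=pF(x)+(1-p)E_\mu(x)$ for $x\ge 0$, with $0<p\le 1$, where $F(x)=\Pr\{\zeta\le x\}$ is the distribution function of a nonnegative random variable $\zeta$ with expectation $1/\mu$; and, with $F_y(x)=\Pr\{\zeta\le x+y\mid\zeta>y\}$ (for all $y\ge0$ with $\Pr\{\zeta>y\}>0$), for a given $\varepsilon>0$, $$\sup_{x,y\ge0}|F_y(x)-F(x)|<\varepsilon .$$ (D) There is $y^0\ge0$ with $\Pr\{\zeta>y^0\}>0$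 such that $F_{y^0}\le_{\mathscr C_\lambda}F_y$ for all $y\ge0$ with $\Pr\{\zeta>y\}>0$. Put $\widehat F(\lambda)=\int_0^\infty e^{-\lambda x}\,dF(x)$ and $\widehat B(\lambda)=p\widehat F(\lambda)+(1-p)\frac{\mu}{\mu+\lambda}$. Then there is a probability distribution on $\{0,1,2,\dots\}$ whose generating function $g$ satisfies $$g(z)<\frac{\widehat B(\lambda)}{1-z+z\widehat B(\lambda)}+5\varepsilon\cdot\frac{1-z+2z\widehat B(\lambda)}{1-z+z\widehat B(\lambda)}\qquad\text{for all real } z,\ |z|\le 1,$$ and such that the following holds. Let $Z_n$ be the size of the $n$-th generation of the Galton–Watson process with $Z_0=1$ and offspring generating function $g$. Let $y^0$ be as in (D), let $G$ be any distribution function of a nonnegative random variable with $G\le_{\mathscr C_\lambda}F_{y^0}$ and $G\le_{\mathscr C_\lambda}E_\mu$, and let $\varsigma_1,\varsigma_2,\dots$ be i.i.d., independent of $Z_n$, with $$\Pr\{\varsigma_i=m\}=\int_0^\infty e^{-\lambda x}\frac{(\lambda x)^m}{m!}\,dG(x),\qquad m=0,1,2,\dots$$ Then $L_n\ge_{st}\sum_{i=1}^{Z_n}\varsigma_i$,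 that is, $\Pr\{L_n\ge k\}\ge\Pr\{\sum_{i=1}^{Z_n}\varsigma_i\ge k\}$ for every $k=0,1,2,\dots$ -/

import Mathlib

open MeasureTheory ProbabilityTheory
open scoped NNReal ENNReal

noncomputable section

namespace LossQueue

/-! ### Distribution functions, residual lives, the order `C_lam` -/

/-- Distribution function `E_mu(x) = 1 - exp (-mu x)` (for `x ≥ 0`) of the exponential law. -/
def expDF (mu x : ℝ) : ℝ := if 0 ≤ x then 1 - Real.exp (-mu * x) else 0

/-- `F_y(x) = Pr{ζ ≤ x + y | ζ > y}` for `ζ` distributed according to `F`.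
It is only used for those `y` with `F (y, ∞) ≠ 0`. -/
def residualDF (F : Measure ℝ) (y x : ℝ) : ℝ :=
  ((ProbabilityTheory.cond F (Set.Ioi y)) (Set.Iic (x + y))).toReal

/-- The relation `Ξ₁ ≤_{C_lam} Ξ₂` between distribution functions of nonnegative
random variables. -/
def LeC (lam : ℝ) (Ξ₁ Ξ₂ : ℝ → ℝ) : Prop :=
  ∀ i : ℕ, ∫ x in Set.Ioi (0 : ℝ), Real.exp (-lam * x) * x ^ i * Ξ₂ x ≤
    ∫ x in Set.Ioi (0 : ℝ), Real.exp (-lam * x) * x ^ i * Ξ₁ x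

/-- `sup_{x, y ≥ 0} |F_y(x) - F(x)|`, over those `y` for which `F_y` is defined. -/
def residualDeviation (F : Measure ℝ) : ℝ :=
  sSup {d : ℝ | ∃ x y : ℝ, 0 ≤ x ∧ 0 ≤ y ∧ F (Set.Ioi y) ≠ 0 ∧
    d = |residualDF F y x - cdf F x|}

/-- Condition (A), with the standing assumption `B(0) = 0` on the service time law. -/
structure ConditionA (B F : Measure ℝ) (mu p ε : ℝ) : Prop where
  mu_pos : 0 < mu
  p_pos : 0 < p
  p_le_one : p ≤ 1
  ε_pos : 0 < ε
  nonneg : F (Set.Iio 0) = 0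
  integrable : Integrable (fun x : ℝ => x) F
  mean : ∫ x, x ∂F = 1 / mu
  service_zero : cdf B 0 = 0
  mixture : ∀ x : ℝ, 0 ≤ x → cdf B x = p * cdf F x + (1 - p) * expDF mu x
  close : residualDeviation F < ε

/-- `F_{y0}` is a member of the family `(F_y)` that is `C_lam`-below all members. -/
def IsMinimalResidual (lam : ℝ) (F : Measure ℝ) (y0 : ℝ) : Prop :=
  0 ≤ y0 ∧ F (Set.Ioi y0) ≠ 0 ∧
    ∀ y : ℝ, 0 ≤ y → F (Set.Ioi y) ≠ 0 → LeC lam (residualDF F y0) (residualDF F y)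

/-- Condition (D). -/
def ConditionD (lam : ℝ) (F : Measure ℝ) : Prop := ∃ y0 : ℝ, IsMinimalResidual lam F y0

/-- Laplace–Stieltjes transform `∫₀^∞ exp (-s x) dF(x)`. -/
def laplace (F : Measure ℝ) (s : ℝ) : ℝ := ∫ x in Set.Ici (0 : ℝ), Real.exp (-s * x) ∂F

/-! ### The M/GI/1/n queue -/

/-- `N` is a (homogeneous) Poisson process of rate `lam`; `N t` is the number of points in
`(0, t]`. -/
structure IsPoissonProcess {Ω : Type*} [MeasurableSpace Ω] (P : Measure Ω) (lam : ℝ)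
    (N : ℝ≥0 → Ω → ℕ) : Prop where
  measurable : ∀ t, Measurable (N t)
  zero : ∀ ω, N 0 ω = 0
  mono : ∀ ω, Monotone fun t => N t ω
  rightCont : ∀ ω t, ContinuousWithinAt (fun s => N s ω) (Set.Ici t) t
  indep : HasIndepIncrements N P
  law : ∀ s t, s ≤ t →
    P.map (fun ω => N t ω - N s ω) = poissonMeasure (lam.toNNReal * (t - s))

/-- The random input of an M/GI/1 system observed from the beginning of a busy period. At time
`0` a customer arrives at the empty system; `N t` is the number of further arrivals in `(0, t]`,
a Poisson process of rate `lam`; `χ j` is the duration of the `j`-th service (`j = 0, 1, …`),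
the `χ j` being i.i.d. with law `B` and independent of the arrivals. -/
structure IsMGIInput {Ω : Type*} [MeasurableSpace Ω] (P : Measure Ω) (lam : ℝ) (B : Measure ℝ)
    (N : ℝ≥0 → Ω → ℕ) (χ : ℕ → Ω → ℝ≥0) : Prop where
  poisson : IsPoissonProcess P lam N
  service_measurable : ∀ j, Measurable (χ j)
  service_law : ∀ j, P.map (fun ω => (χ j ω : ℝ)) = B
  service_indep : iIndepFun χ P
  input_indep : IndepFun (fun ω t => N t ω) (fun ω j => χ j ω) P

/-- In a busy period services follow one another without interruption: `serviceStart χ j` is the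
beginning of the `j`-th service and the end of the `(j-1)`-st one. Argument: a path of `χ`. -/
def serviceStart (χ : ℕ → ℝ≥0) (j : ℕ) : ℝ≥0 := ∑ i ∈ Finset.range j, χ i

/-- Number of customers arriving during the `j`-th service (arguments: paths of `N`, `χ`). -/
def arrivalsIn (N : ℝ≥0 → ℕ) (χ : ℕ → ℝ≥0) (j : ℕ) : ℕ :=
  N (serviceStart χ (j + 1)) - N (serviceStart χ j)

/-- Number of customers in the system (waiting or in service) at the beginning of the `j`-th
service of the busy period, when `a i` customers arrive during the `i`-th service; `n` is the
buffer size excluding the customer in service, so the system holds at most `n + 1` customers.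
The value `0` means that the busy period is over before the `j`-th service. -/
def systemSize (n : ℕ) (a : ℕ → ℕ) : ℕ → ℕ
  | 0 => 1
  | j + 1 => if systemSize n a j = 0 then 0 else min (systemSize n a j + a j) (n + 1) - 1

/-- Number of customers lost during the `j`-th service of the busy period: the arrivals
that meet `n + 1` customers in the system (truncated subtraction is the positive part). -/
def lossesIn (n : ℕ) (a : ℕ → ℕ) (j : ℕ) : ℕ :=
  if systemSize n a j = 0 then 0 else systemSize n a j + a j - (n + 1)

/-- `L_n`: the total number of losses during the busy period. -/
def losses {Ω : Type*} (n : ℕ) (N : ℝ≥0 → Ω → ℕ) (χ : ℕ → Ω → ℝ≥0) (ω : Ω) : ℕ∞ :=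
  ⨆ J : ℕ, ((∑ j ∈ Finset.range J,
    lossesIn n (arrivalsIn (fun t => N t ω) (fun i => χ i ω)) j : ℕ) : ℕ∞)

/-! ### Galton–Watson processes and random sums, through their laws -/

/-- Law of the sum of `k` i.i.d. variables with law `q`. -/
def iidSum (q : PMF ℕ) : ℕ → PMF ℕ
  | 0 => PMF.pure 0
  | k + 1 => (iidSum q k).bind fun s => q.map fun x => s + x

/-- Law of the `m`-th generation `Z_m` of the Galton–Watson process with `Z_0 = 1` and offspring
law `q`: given `Z_m = z`, `Z_{m+1}` is the sum of `z` i.i.d. variables with law `q`. -/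
def galtonWatson (q : PMF ℕ) : ℕ → PMF ℕ
  | 0 => PMF.pure 1
  | m + 1 => (galtonWatson q m).bind (iidSum q)

/-- Law of `∑_{i=1}^{Z} ς_i`, the `ς_i` i.i.d. with law `s` and independent of `Z`, which
has law `ν`. -/
def randomSum (ν s : PMF ℕ) : PMF ℕ := ν.bind (iidSum s)

/-- Probability generating function of a law on `ℕ`. -/
def pgf (q : PMF ℕ) (z : ℝ) : ℝ := ∑' m : ℕ, (q m).toReal * z ^ m

/-- `s` is the law `Pr{ς = m} = ∫₀^∞ exp (-lam x) (lam x)^m / m! dG(x)`. -/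
def IsMixedPoisson (lam : ℝ) (G : Measure ℝ) (s : PMF ℕ) : Prop :=
  ∀ m : ℕ, (s m).toReal =
    ∫ x in Set.Ici (0 : ℝ), Real.exp (-lam * x) * (lam * x) ^ m / (m.factorial : ℝ) ∂G

/-- The random variable `X` stochastically dominates the law `ν`: `Pr{X ≥ k} ≥ ν [k, ∞)`
for all `k`. -/
def StochDominates {Ω : Type*} [MeasurableSpace Ω] (P : Measure Ω) (X : Ω → ℕ∞) (ν : PMF ℕ) :
    Prop :=
  ∀ k : ℕ, ν.toMeasure (Set.Ici k) ≤ P {ω | (k : ℕ∞) ≤ X ω}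

end LossQueue

end

/-! Let `π` be the law of the number of arrivals in one service, `b = π 0 = β` and `c = 1 - b`. Call
an excursion with room `m` the time from the start of a service with `m` free places until the
number of customers has dropped by one. If `a` customers arrive in its first service, then `a - m`
(positive part) are lost at once, and the admitted ones open independent excursions with room `m, m
- 1, ...`. A family of laws `W m` that satisfies this recursion as a stochastic inequality is a
family of lower bounds for the true losses: the expected value of a monotone function of the losses
so far plus independent `W`-losses for the customers present does not decrease along the queue, and
the queue empties almost surely because `b > 0` (`expect_lossesFrom_le`,
`expect_le_measure_losses`).

Such a family comes from two tail bounds: `t * π[k, ∞) ≤ π[k+1, ∞)` and `π[k, ∞) * s[m, ∞) ≤ π[k+m,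
∞)`. After `k` arrivals in a service, one more comes with conditional probability at least `t`, and
the number still to come dominates `s`. Reading arrivals one at a time gives lower bounds `M m` for
the rest of an interrupted service and `W m` for a whole excursion, with `M 0 = W 0 = s`, `M (m+1) =
r δ₀ + t W (m+1) * M m` and `W (m+1) = b δ₀ + c W (m+1) * M m`, where `r = 1 - t` and `*` between
laws is convolution. The last equation makes `W (m+1)` a geometric sum of copies of `M m`. Hence `M
(m+1)` is a random sum of copies of `M m` whose number has mass `r` at `0` and `t * g k` at `k + 1`,
with `g` geometric. This is the offspring law, and `M n` is the law of the sum over the `n`-th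
generation. Since `t ≤ c`, `M n` lies below `W n`, which lies below `L_n`.

For the tail bounds, at least `k + 1` arrivals means that an Erlang time is shorter than the
service, so tails of `π` and `s` are Erlang integrals of survival functions, and the order `C_lam`
compares exactly such integrals. Bounds on residual lives pass to `π` by the convolution rule for
Erlang densities (`mul_integral_erlang_le`), the exponential part of `B` being its own residual.

The generating function equals `(β + (1 - β - t)(1 - z)) / (1 - z + z β)`, so its bound reduces to
`(1 - 5 ε)(1 - β) < t` (`ConditionA.lt_min_residual`). Here `t` is the smaller of the arrival
probabilities in the minimal residual and in an exponential service. By condition (A) the integrated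
tail of the survival function is nearly proportional to that function. This forces exponential
decay, and the equation for the minimal residual then keeps it from being much shorter than `ζ` or
than the exponential. -/

namespace LossQueue

/-! ### Expectations and convolutions of laws on `ℕ` -/

/-- Expectation of `f` under the law `μ`. -/
noncomputable def expect (μ : PMF ℕ) (f : ℕ → ℝ≥0∞) : ℝ≥0∞ := ∑' x, μ x * f x

/-- Convolution of two laws on `ℕ`. -/
noncomputable def conv (μ ν : PMF ℕ) : PMF ℕ := μ.bind fun x => ν.map fun y => x + y

/-- Tail `μ [k, ∞)`. -/
noncomputable def tail (μ : PMF ℕ) (k : ℕ) : ℝ≥0∞ := ∑' j, μ (k + j)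

lemma expect_pure (x : ℕ) (f : ℕ → ℝ≥0∞) : expect (PMF.pure x) f = f x := by
  unfold expect
  rw [tsum_eq_single x]
  · simp
  · intro y hy
    simp [PMF.pure_apply, hy]

lemma expect_bind (μ : PMF ℕ) (ν : ℕ → PMF ℕ) (f : ℕ → ℝ≥0∞) :
    expect (μ.bind ν) f = ∑' x, μ x * expect (ν x) f := by
  unfold expect
  simp_rw [PMF.bind_apply, ← ENNReal.tsum_mul_right, ← ENNReal.tsum_mul_left]
  rw [ENNReal.tsum_comm]
  simp_rw [mul_assoc]

lemma expect_map (μ : PMF ℕ) (g : ℕ → ℕ) (f : ℕ → ℝ≥0∞) :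
    expect (μ.map g) f = expect μ fun x => f (g x) := by
  rw [← PMF.bind_pure_comp, expect_bind]
  simp_rw [Function.comp_apply, expect_pure]
  rfl

lemma expect_conv (μ ν : PMF ℕ) (f : ℕ → ℝ≥0∞) :
    expect (conv μ ν) f = expect μ fun x => expect ν fun y => f (x + y) := by
  unfold conv
  rw [expect_bind]
  simp_rw [expect_map]
  rfl

lemma expect_mono (μ : PMF ℕ) {f g : ℕ → ℝ≥0∞} (h : ∀ x, f x ≤ g x) : expect μ f ≤ expect μ g :=
  ENNReal.tsum_le_tsum fun x => mul_le_mul_right (h x) _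

lemma expect_const (μ : PMF ℕ) (c : ℝ≥0∞) : expect μ (fun _ => c) = c := by
  unfold expect
  rw [ENNReal.tsum_mul_right, μ.tsum_coe, one_mul]

lemma expect_tsum (μ : PMF ℕ) (w : ℕ → ℝ≥0∞) (g : ℕ → ℕ → ℝ≥0∞) :
    expect μ (fun x => ∑' a, w a * g a x) = ∑' a, w a * expect μ (g a) := by
  unfold expect
  simp_rw [← ENNReal.tsum_mul_left]
  rw [ENNReal.tsum_comm]
  simp_rw [mul_left_comm]

lemma expect_mul_left (μ : PMF ℕ) (c : ℝ≥0∞) (f : ℕ → ℝ≥0∞) :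
    expect μ (fun x => c * f x) = c * expect μ f := by
  unfold expect
  rw [← ENNReal.tsum_mul_left]
  simp_rw [mul_left_comm]

lemma expect_indicator (μ : PMF ℕ) (k : ℕ) :
    expect μ (fun x => if k ≤ x then 1 else 0) = μ.toMeasure (Set.Ici k) := by
  rw [PMF.toMeasure_apply]
  · unfold expect
    refine tsum_congr fun x => ?_
    by_cases h : k ≤ x <;> simp [h]
  · exact measurableSet_Ici

lemma tail_zero (μ : PMF ℕ) : tail μ 0 = 1 := by
  unfold tail
  simp

lemma tail_succ (μ : PMF ℕ) (k : ℕ) : tail μ k = μ k + tail μ (k + 1) := by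
  unfold tail
  rw [tsum_eq_zero_add' ENNReal.summable]
  simp [add_assoc, add_comm 1]

lemma tail_le_one (μ : PMF ℕ) (k : ℕ) : tail μ k ≤ 1 := by
  rw [← μ.tsum_coe]
  exact ENNReal.tsum_comp_le_tsum_of_injective (add_right_injective k) _

/-- Summation by parts, which reduces monotone test functions to tails. Monotonicity makes the
truncated differences telescope, even through the value `∞`. -/
lemma tsum_mul_monotone (w f : ℕ → ℝ≥0∞) (hf : Monotone f) :
    ∑' x, w x * f x = (∑' x, w x) * f 0 + ∑' j, (f (j + 1) - f j) * ∑' i, w (j + 1 + i) := by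
  have h1 : ∀ x, f x = f 0 + ∑ j ∈ Finset.range x, (f (j + 1) - f j) := by
    intro x
    induction x with
    | zero => simp
    | succ x ih =>
      rw [Finset.sum_range_succ, ← add_assoc, ← ih, add_tsub_cancel_of_le (hf (Nat.le_succ x))]
  have h2 : ∀ x, ∑ j ∈ Finset.range x, (f (j + 1) - f j)
      = ∑' j, if j < x then f (j + 1) - f j else 0 := by
    intro x
    rw [tsum_eq_sum (s := Finset.range x)]
    · exact Finset.sum_congr rfl fun j hj => by simp [Finset.mem_range.1 hj]
    · intro j hj
      simp only [Finset.mem_range] at hj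
      simp [hj]
  have h3 : ∀ j, ∑' x, (w x * if j < x then f (j + 1) - f j else 0)
      = (f (j + 1) - f j) * ∑' i, w (j + 1 + i) := by
    intro j
    rw [← (ENNReal.summable).sum_add_tsum_nat_add' (k := j + 1), Finset.sum_eq_zero, zero_add,
      ← ENNReal.tsum_mul_left]
    · refine tsum_congr fun i => ?_
      have : j < i + (j + 1) := by omega
      rw [if_pos this, mul_comm, add_comm i]
    · intro i hi
      have : ¬ j < i := by have := Finset.mem_range.1 hi; omega
      simp [this]
  calc ∑' x, w x * f x
      = ∑' x, (w x * f 0 + ∑' j, w x * if j < x then f (j + 1) - f j else 0) := by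
        refine tsum_congr fun x => ?_
        rw [ENNReal.tsum_mul_left, ← h2, ← mul_add, ← h1]
    _ = _ := by
        rw [ENNReal.tsum_add, ENNReal.tsum_mul_right, ENNReal.tsum_comm]
        simp_rw [h3]

/-! ### Random sums -/

lemma conv_assoc (μ ν κ : PMF ℕ) : conv (conv μ ν) κ = conv μ (conv ν κ) := by
  simp only [conv, PMF.bind_bind, ← PMF.bind_pure_comp, Function.comp_def, PMF.pure_bind, add_assoc]

lemma conv_pure_zero (μ : PMF ℕ) : conv μ (PMF.pure 0) = μ := by
  simp [conv, PMF.pure_map]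

lemma pure_zero_conv (μ : PMF ℕ) : conv (PMF.pure 0) μ = μ := by
  simp only [conv, PMF.pure_bind, zero_add]
  exact PMF.map_id μ

lemma iidSum_succ (s : PMF ℕ) (k : ℕ) : iidSum s (k + 1) = conv (iidSum s k) s := rfl

lemma iidSum_add (s : PMF ℕ) (a b : ℕ) : iidSum s (a + b) = conv (iidSum s a) (iidSum s b) := by
  induction b with
  | zero => exact (conv_pure_zero _).symm
  | succ b ih => rw [← add_assoc, iidSum_succ, ih, conv_assoc, iidSum_succ]

lemma iidSum_one (s : PMF ℕ) : iidSum s 1 = s := pure_zero_conv s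

lemma conv_bind_iidSum (μ ν s : PMF ℕ) :
    (conv μ ν).bind (iidSum s) = conv (μ.bind (iidSum s)) (ν.bind (iidSum s)) := by
  simp only [conv, PMF.bind_bind, ← PMF.bind_pure_comp, Function.comp_def, PMF.pure_bind]
  congr 1
  funext x
  simp_rw [iidSum_add, conv, ← PMF.bind_pure_comp, Function.comp_def]
  rw [PMF.bind_comm]

lemma iidSum_randomSum (q s : PMF ℕ) (k : ℕ) :
    iidSum (randomSum q s) k = (iidSum q k).bind (iidSum s) := by
  induction k with
  | zero =>
    show PMF.pure 0 = (PMF.pure 0).bind (iidSum s)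
    rw [PMF.pure_bind]
    rfl
  | succ k ih => rw [iidSum_succ, iidSum_succ, conv_bind_iidSum, ih]; rfl

/-- Grouping the summands by parent in the preceding generation replaces `s` by `randomSum q s` and
lowers the generation by one. -/
lemma randomSum_galtonWatson (q s : PMF ℕ) (n : ℕ) :
    randomSum (galtonWatson q n) s = (randomSum q)^[n] s := by
  induction n generalizing s with
  | zero =>
    show (PMF.pure 1).bind _ = s
    rw [PMF.pure_bind, iidSum_one]
  | succ n ih =>
    rw [Function.iterate_succ_apply, ← ih]
    show ((galtonWatson q n).bind (iidSum q)).bind (iidSum s)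
      = (galtonWatson q n).bind (iidSum (randomSum q s))
    rw [PMF.bind_bind]
    congr 1
    funext k
    rw [iidSum_randomSum]

lemma expect_randomSum (ν s : PMF ℕ) (f : ℕ → ℝ≥0∞) :
    expect (randomSum ν s) f = ∑' k, ν k * expect (iidSum s k) f := expect_bind _ _ _

/-- A nonempty sum is one summand plus a sum with `g`-distributed length. It serves both for the
offspring law and for the geometric law, which is its own shift. -/
lemma expect_randomSum_zero_modified {g q : PMF ℕ} {r t : ℝ≥0∞} (h0 : q 0 = r)
    (hs : ∀ k, q (k + 1) = t * g k) (s : PMF ℕ) (f : ℕ → ℝ≥0∞) :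
    expect (randomSum q s) f
      = r * f 0 + t * expect (randomSum g s) fun x => expect s fun y => f (x + y) := by
  rw [expect_randomSum, expect_randomSum, tsum_eq_zero_add' ENNReal.summable, h0]
  congr 1
  · rw [show iidSum s 0 = PMF.pure 0 from rfl, expect_pure]
  · rw [← ENNReal.tsum_mul_left]
    refine tsum_congr fun k => ?_
    rw [hs, iidSum_succ, expect_conv, mul_assoc]

/-! ### Losses of an excursion -/

/-- Expectation of `f` at the losses of an excursion above a level that has room for `m` more
customers, when `a` customers still arrive in the current service and `W i` is the law of the
losses of an excursion that begins with a service and has room for `i` more customers. -/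
noncomputable def excursion (W : ℕ → PMF ℕ) : ℕ → ℕ → (ℕ → ℝ≥0∞) → ℝ≥0∞
  | 0, a, f => f a
  | _ + 1, 0, f => f 0
  | m + 1, a + 1, f => expect (W (m + 1)) fun x => excursion W m a fun y => f (x + y)

/-- Moving weight from `A` to the larger `B` increases the weighted sum. The amount moved is the
excess `e` of `p'` over `t * (p + p')`. -/
lemma convex_step {p p' r t A B : ℝ≥0∞} (hrt : r + t = 1) (hp : t * (p + p') ≤ p')
    (hAB : A ≤ B) : (p + p') * (r * A + t * B) ≤ p * A + p' * B := by
  obtain ⟨e, he⟩ : ∃ e, p' = t * (p + p') + e := exists_add_of_le hp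
  by_cases hfin : t * (p + p') = ∞
  · have hp' : p' = ∞ := by rw [hfin] at hp; exact top_unique hp
    by_cases hB : B = 0
    · have hA : A = 0 := by simpa [hB] using hAB
      simp [hA, hB]
    · simp [hp', ENNReal.top_mul hB]
  have hpe : p + e = r * (p + p') := by
    have h1 : t * (p + p') + (p + e) = t * (p + p') + r * (p + p') := by
      rw [← add_mul, add_comm t r, hrt, one_mul, add_left_comm, ← he]
    exact (ENNReal.add_right_inj hfin).1 h1
  calc (p + p') * (r * A + t * B) = r * (p + p') * A + t * (p + p') * B := by ring
    _ = p * A + (e * A + t * (p + p') * B) := by rw [← hpe]; ring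
    _ ≤ p * A + (e * B + t * (p + p') * B) := by gcongr
    _ = p * A + (t * (p + p') + e) * B := by ring
    _ = p * A + p' * B := by rw [← he]

section Excursion

variable {π s : PMF ℕ} {W M : ℕ → PMF ℕ} {b c r t : ℝ≥0∞}

lemma tail_mul_expect_le (hst : ∀ k m, tail π k * tail s m ≤ tail π (k + m)) (k : ℕ)
    {f : ℕ → ℝ≥0∞} (hf : Monotone f) : tail π k * expect s f ≤ ∑' a, π (k + a) * f a := by
  unfold expect
  rw [tsum_mul_monotone _ f hf, tsum_mul_monotone _ f hf, s.tsum_coe, one_mul, mul_add,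
    ← ENNReal.tsum_mul_left]
  refine add_le_add le_rfl (ENNReal.tsum_le_tsum fun j => ?_)
  rw [mul_left_comm]
  refine mul_le_mul_right ?_ _
  have := hst k (j + 1)
  unfold tail at this
  simpa only [tail, add_assoc] using this

/-- The service is known to contain at least `k` arrivals, and `M m` bounds what follows when `m`
places are left. The induction reads one arrival: it uses up a place and raises `k` by one, so `k`
must be arbitrary. `convex_step` replaces the true conditional probability of a further arrival by
the smaller `t`. -/
lemma tail_mul_expect_le_excursion (hrt : r + t = 1)
    (ht : ∀ k, t * tail π k ≤ tail π (k + 1))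
    (hst : ∀ k m, tail π k * tail s m ≤ tail π (k + m)) (hM0 : M 0 = s)
    (hM : ∀ m f, expect (M (m + 1)) f
      = r * f 0 + t * expect (W (m + 1)) fun x => expect (M m) fun y => f (x + y))
    (m k : ℕ) {f : ℕ → ℝ≥0∞} (hf : Monotone f) :
    tail π k * expect (M m) f ≤ ∑' a, π (k + a) * excursion W m a f := by
  induction m generalizing k f with
  | zero =>
    rw [hM0]
    exact tail_mul_expect_le hst k hf
  | succ m ih =>
    set B := expect (W (m + 1)) fun x => expect (M m) fun y => f (x + y) with hB
    have hAB : f 0 ≤ B := by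
      rw [← expect_const (W (m + 1)) (f 0), hB]
      refine expect_mono _ fun x => ?_
      rw [← expect_const (M m) (f 0)]
      exact expect_mono _ fun y => hf (Nat.zero_le _)
    have hp := ht k
    rw [tail_succ π k] at hp
    rw [hM, tail_succ π k]
    refine (convex_step hrt hp hAB).trans ?_
    rw [tsum_eq_zero_add' ENNReal.summable]
    refine add_le_add le_rfl ?_
    calc tail π (k + 1) * B
        = expect (W (m + 1)) fun x => tail π (k + 1) * expect (M m) fun y => f (x + y) := by
          rw [expect_mul_left]
      _ ≤ expect (W (m + 1)) fun x => ∑' a, π (k + 1 + a) * excursion W m a fun y => f (x + y) :=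
          expect_mono _ fun x => ih (k + 1) fun y z hyz => hf (by gcongr)
      _ = ∑' a, π (k + 1 + a) * expect (W (m + 1)) fun x => excursion W m a fun y => f (x + y) :=
          expect_tsum _ _ fun a x => excursion W m a fun y => f (x + y)
      _ = _ := tsum_congr fun a => by rw [add_assoc, add_comm 1 a]; rfl

/-- In a fresh service the probabilities `b` and `c` of no arrival and of some arrival are exact.
After the first arrival the preceding lemma applies with `k = 1`. -/
lemma expect_le_excursion (hrt : r + t = 1) (hπ : π 0 = b) (hbc : b + c = 1)
    (ht : ∀ k, t * tail π k ≤ tail π (k + 1))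
    (hst : ∀ k m, tail π k * tail s m ≤ tail π (k + m)) (hM0 : M 0 = s) (hW0 : W 0 = s)
    (hM : ∀ m f, expect (M (m + 1)) f
      = r * f 0 + t * expect (W (m + 1)) fun x => expect (M m) fun y => f (x + y))
    (hW : ∀ m f, expect (W (m + 1)) f
      = b * f 0 + c * expect (W (m + 1)) fun x => expect (M m) fun y => f (x + y))
    (m : ℕ) {f : ℕ → ℝ≥0∞} (hf : Monotone f) :
    expect (W m) f ≤ ∑' a, π a * excursion W m a f := by
  cases m with
  | zero =>
    rw [hW0]
    have := tail_mul_expect_le hst 0 hf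
    rw [tail_zero, one_mul] at this
    simpa [excursion] using this
  | succ m =>
    have hc : tail π 1 = c := by
      have := tail_succ π 0
      rw [tail_zero, hπ, ← hbc, zero_add] at this
      have hb : b ≠ ∞ := by rw [← hπ]; exact π.apply_ne_top 0
      exact ((ENNReal.add_right_inj hb).1 this).symm
    rw [hW, tsum_eq_zero_add' ENNReal.summable, hπ]
    refine add_le_add le_rfl ?_
    calc c * (expect (W (m + 1)) fun x => expect (M m) fun y => f (x + y))
        = expect (W (m + 1)) fun x => tail π 1 * expect (M m) fun y => f (x + y) := by
          rw [expect_mul_left, hc]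
      _ ≤ expect (W (m + 1)) fun x => ∑' a, π (1 + a) * excursion W m a fun y => f (x + y) :=
          expect_mono _ fun x => tail_mul_expect_le_excursion hrt ht hst hM0 hM m 1
            fun y z hyz => hf (by gcongr)
      _ = ∑' a, π (1 + a) * expect (W (m + 1)) fun x => excursion W m a fun y => f (x + y) :=
          expect_tsum _ _ fun a x => excursion W m a fun y => f (x + y)
      _ = _ := tsum_congr fun a => by rw [add_comm 1 a]; rfl

end Excursion

/-- Law of the losses until the system is empty, from the beginning of a service with `i`
customers in a system with buffer `n`. -/
noncomputable def lossesFrom (W : ℕ → PMF ℕ) (n : ℕ) : ℕ → PMF ℕ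
  | 0 => PMF.pure 0
  | i + 1 => conv (lossesFrom W n i) (W (n - i))

/-- Each admitted arrival raises the level left after the service by one and so adds the factor `W
(n - j)` to `lossesFrom`. The same factor is split off by one step of `excursion`. -/
lemma expect_lossesFrom_next (W : ℕ → PMF ℕ) (n j m a : ℕ) (h : j + m = n) (f : ℕ → ℝ≥0∞) :
    expect (lossesFrom W n (j + min a m)) (fun y => f (y + (a - m)))
      = expect (lossesFrom W n j) fun x => excursion W m a fun y => f (x + y) := by
  induction m generalizing j a f with
  | zero => simp [excursion]
  | succ m ih =>
    cases a with
    | zero => simp [excursion]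
    | succ a =>
      have h1 : j + min (a + 1) (m + 1) = (j + 1) + min a m := by omega
      have h2 : n - j = m + 1 := by omega
      rw [h1, Nat.add_sub_add_right, ih (j + 1) a (by omega), lossesFrom, expect_conv, h2]
      simp only [excursion, add_assoc]

/-- One-step submartingale inequality. Only the top customer's excursion is expanded; the `j`
excursions below it are independent of it and merely shift `f`. -/
lemma expect_lossesFrom_le {π : PMF ℕ} {W : ℕ → PMF ℕ}
    (h : ∀ m (f : ℕ → ℝ≥0∞), Monotone f → expect (W m) f ≤ ∑' a, π a * excursion W m a f)
    {n j : ℕ} (hj : j ≤ n) {f : ℕ → ℝ≥0∞} (hf : Monotone f) :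
    expect (lossesFrom W n (j + 1)) f
      ≤ ∑' a, π a * expect (lossesFrom W n (min (j + 1 + a) (n + 1) - 1))
          fun y => f (y + (j + 1 + a - (n + 1))) := by
  obtain ⟨m, rfl⟩ := Nat.exists_eq_add_of_le hj
  have h1 : ∀ a, min (j + 1 + a) (j + m + 1) - 1 = j + min a m := fun a => by omega
  have h2 : ∀ a, j + 1 + a - (j + m + 1) = a - m := fun a => by omega
  simp_rw [h1, h2, expect_lossesFrom_next W (j + m) j m _ rfl f]
  rw [lossesFrom, expect_conv, Nat.add_sub_cancel_left]
  rw [← expect_tsum _ _ fun a x => excursion W m a fun y => f (x + y)]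
  exact expect_mono _ fun x => h m _ fun y z hyz => hf (by gcongr)

/-! ### Losses of a queue with i.i.d. numbers of arrivals per service -/

lemma systemSize_congr {n : ℕ} {a a' : ℕ → ℕ} {j : ℕ} (h : ∀ i < j, a i = a' i) :
    systemSize n a j = systemSize n a' j := by
  induction j with
  | zero => rfl
  | succ j ih => rw [systemSize, systemSize, ih fun i hi => h i (by omega), h j (by omega)]

lemma lossesIn_congr {n : ℕ} {a a' : ℕ → ℕ} {j : ℕ} (h : ∀ i < j + 1, a i = a' i) :
    lossesIn n a j = lossesIn n a' j := by
  rw [lossesIn, lossesIn, systemSize_congr fun i hi => h i (by omega), h j (by omega)]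

lemma systemSize_le (n : ℕ) (a : ℕ → ℕ) (j : ℕ) : systemSize n a j ≤ n + 1 := by
  cases j with
  | zero => simp [systemSize]
  | succ j => rw [systemSize]; split_ifs <;> omega

/-- State (system size and accumulated losses) at the beginning of the `J`-th service. -/
def queueState (n : ℕ) (a : ℕ → ℕ) (J : ℕ) : ℕ × ℕ :=
  (systemSize n a J, ∑ j ∈ Finset.range J, lossesIn n a j)

/-- Transition of `queueState` when `x` customers arrive during the service. -/
def queueStep (n : ℕ) (z : ℕ × ℕ) (x : ℕ) : ℕ × ℕ :=
  if z.1 = 0 then z else (min (z.1 + x) (n + 1) - 1, z.2 + (z.1 + x - (n + 1)))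

lemma queueState_succ (n : ℕ) (a : ℕ → ℕ) (J : ℕ) :
    queueState n a (J + 1) = queueStep n (queueState n a J) (a J) := by
  simp only [queueState, queueStep, Finset.sum_range_succ, systemSize, lossesIn]
  split_ifs with h <;> simp [h]

lemma queueState_congr {n : ℕ} {a a' : ℕ → ℕ} {J : ℕ} (h : ∀ i < J, a i = a' i) :
    queueState n a J = queueState n a' J := by
  unfold queueState
  rw [systemSize_congr h, Finset.sum_congr rfl fun j hj =>
    lossesIn_congr fun i hi => h i (by have := Finset.mem_range.1 hj; omega)]

/-! ### The Markov chain of system size and accumulated losses -/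

section Chain

variable {Ω : Type*} [MeasurableSpace Ω] {P : Measure Ω}
  {a : ℕ → Ω → ℕ} {π : PMF ℕ}

lemma measurable_queueState (ha : ∀ j, Measurable (a j)) (n J : ℕ) :
    Measurable fun ω => queueState n (fun i => a i ω) J := by
  induction J with
  | zero => simp [queueState, systemSize]
  | succ J ih =>
    simp_rw [queueState_succ]
    exact (measurable_of_countable (fun z : (ℕ × ℕ) × ℕ => queueStep n z.1 z.2)).comp
      (ih.prodMk (ha J))

lemma indepFun_queueState (ha : ∀ j, Measurable (a j)) (hi : iIndepFun a P) (n J : ℕ) :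
    IndepFun (fun ω => queueState n (fun i => a i ω) J) (a J) P := by
  have h := hi.indepFun_finset (Finset.range J) {J} (by simp) ha
  have h' := h.comp
    (φ := fun v : (Finset.range J → ℕ) =>
      -- The state before service `J` depends only on earlier arrivals, so the filler value `0` has
      -- no effect.
      queueState n (fun i => if hi : i ∈ Finset.range J then v ⟨i, hi⟩ else 0) J)
    (ψ := fun v : (({J} : Finset ℕ) → ℕ) => v ⟨J, by simp⟩)
    (measurable_of_countable _) (measurable_of_countable _)
  convert! h' using 1
  funext ω
  refine queueState_congr fun i hi => ?_
  simp [hi]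

variable [IsProbabilityMeasure P]

lemma lintegral_queueState_succ (ha : ∀ j, Measurable (a j)) (hi : iIndepFun a P)
    (hπ : ∀ j x, P {ω | a j ω = x} = π x) (n J : ℕ) (F : ℕ × ℕ → ℝ≥0∞) :
    ∫⁻ ω, F (queueState n (fun i => a i ω) (J + 1)) ∂P
      = ∫⁻ ω, ∑' x, π x * F (queueStep n (queueState n (fun i => a i ω) J) x) ∂P := by
  have hm := measurable_queueState ha n J
  simp_rw [queueState_succ]
  rw [← lintegral_map (f := fun z : (ℕ × ℕ) × ℕ => F (queueStep n z.1 z.2))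
      (g := fun ω => (queueState n (fun i => a i ω) J, a J ω)) (measurable_of_countable _)
      (hm.prodMk (ha J)),
    (indepFun_iff_map_prod_eq_prod_map_map hm.aemeasurable (ha J).aemeasurable).1
      (indepFun_queueState ha hi n J), lintegral_prod _ (measurable_of_countable _).aemeasurable,
    lintegral_map (measurable_of_countable _) hm]
  refine lintegral_congr fun ω => ?_
  rw [lintegral_countable']
  refine tsum_congr fun x => ?_
  rw [Measure.map_apply (ha J) (measurableSet_singleton x), mul_comm, ← hπ J x]
  rfl

/-- Lyapunov function of the system size. -/
noncomputable def geomHeight (b : ℝ≥0∞) (i : ℕ) : ℝ≥0∞ := ∑ l ∈ Finset.range i, b ^ l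

lemma geomHeight_mono (b : ℝ≥0∞) : Monotone (geomHeight b) := fun _ _ h =>
  Finset.sum_le_sum_of_subset (Finset.range_mono h)

lemma geomHeight_succ (b : ℝ≥0∞) (i : ℕ) : geomHeight b (i + 1) = 1 + b * geomHeight b i := by
  unfold geomHeight
  rw [Finset.sum_range_succ', pow_zero, add_comm, Finset.mul_sum]
  simp_rw [pow_succ']

lemma geomHeight_add_pow {b c : ℝ≥0∞} (h : b + c = 1) (i : ℕ) :
    c * geomHeight b i + b ^ i = 1 := by
  induction i with
  | zero => simp [geomHeight]
  | succ i ih =>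
    rw [geomHeight_succ, pow_succ']
    calc c * (1 + b * geomHeight b i) + b * b ^ i = c + b * (c * geomHeight b i + b ^ i) := by ring
      _ = 1 := by rw [ih, mul_one, add_comm, h]

/-- With no arrival the size drops by one; otherwise the next size is at most `n`. The geometric
weights are chosen so that `b h(i) + c h(n) + b ^ n = b h(i) + 1 = h(i + 1)`, a downward drift of at
least `b ^ n` at every busy step. -/
lemma geomHeight_drift {b c : ℝ≥0∞} (hbc : b + c = 1) (hb : π 0 = b) {n i : ℕ} (h0 : i ≠ 0)
    (hi : i ≤ n + 1) :
    ∑' x, π x * geomHeight b (min (i + x) (n + 1) - 1) + b ^ n ≤ geomHeight b i := by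
  obtain ⟨i, rfl⟩ := Nat.exists_eq_succ_of_ne_zero h0
  have hc : ∑' x, π (x + 1) = c := by
    have := tail_succ π 0
    rw [tail_zero, hb, ← hbc, zero_add] at this
    have hb : b ≠ ∞ := by rw [← hb]; exact π.apply_ne_top 0
    rw [(ENNReal.add_right_inj hb).1 this, tail]
    simp_rw [add_comm]
  rw [tsum_eq_zero_add' ENNReal.summable, hb]
  have h1 : min (i.succ + 0) (n + 1) - 1 = i := by omega
  rw [h1, geomHeight_succ, add_assoc, add_comm 1]
  refine add_le_add le_rfl ?_
  rw [← geomHeight_add_pow hbc n]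
  refine add_le_add ?_ le_rfl
  rw [← hc, ← ENNReal.tsum_mul_right]
  exact ENNReal.tsum_le_tsum fun x => mul_le_mul_right (geomHeight_mono b (by omega)) _

/-- Summing the drift bounds `b ^ n` times the expected number of services by the initial height
`1`, so the probabilities of being busy are summable. -/
lemma tendsto_measure_systemSize_ne_zero (ha : ∀ j, Measurable (a j)) (hi : iIndepFun a P)
    (hπ : ∀ j x, P {ω | a j ω = x} = π x) (h0 : π 0 ≠ 0) (n : ℕ) :
    Filter.Tendsto (fun J => P {ω | systemSize n (fun i => a i ω) J ≠ 0}) Filter.atTop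
      (nhds 0) := by
  set b := π 0 with hb
  have hbc : b + tail π 1 = 1 := by rw [← tail_zero π, tail_succ π 0]
  have hbtop : b ≠ ∞ := π.apply_ne_top 0
  set p : ℕ → ℝ≥0∞ := fun J => P {ω | systemSize n (fun i => a i ω) J ≠ 0} with hp
  set H : ℕ → ℝ≥0∞ := fun J => ∫⁻ ω, geomHeight b (queueState n (fun i => a i ω) J).1 ∂P with hH
  have hmeas : ∀ J, MeasurableSet {ω | systemSize n (fun i => a i ω) J ≠ 0} := fun J =>
    (measurable_queueState ha n J) (Set.to_countable {z : ℕ × ℕ | z.1 ≠ 0}).measurableSet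
  have hstep : ∀ J, H (J + 1) + b ^ n * p J ≤ H J := by
    intro J
    have e : b ^ n * p J
        = ∫⁻ ω, {ω | systemSize n (fun i => a i ω) J ≠ 0}.indicator (fun _ => b ^ n) ω ∂P := by
      rw [lintegral_indicator (hmeas J), setLIntegral_const]
    simp only [hH]
    rw [lintegral_queueState_succ ha hi hπ n J (fun z => geomHeight b z.1), e,
      ← lintegral_add_right _ (measurable_const.indicator (hmeas J))]
    refine lintegral_mono fun ω => ?_
    by_cases hz : systemSize n (fun i => a i ω) J = 0
    · simp [hz, queueStep, queueState, geomHeight]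
    · simp only [queueStep, queueState, hz, if_false]
      rw [Set.indicator_of_mem (by exact hz)]
      exact geomHeight_drift hbc hb.symm hz (systemSize_le n _ J)
  have hsum : ∀ J, H J + ∑ j ∈ Finset.range J, b ^ n * p j ≤ H 0 := by
    intro J
    induction J with
    | zero => simp
    | succ J ih =>
      rw [Finset.sum_range_succ, add_comm _ (b ^ n * p J), ← add_assoc]
      exact (add_le_add (hstep J) le_rfl).trans ih
  have hH0 : H 0 = 1 := by simp [hH, queueState, systemSize, geomHeight]
  have htsum : b ^ n * ∑' j, p j ≤ 1 := by
    rw [← ENNReal.tsum_mul_left, ENNReal.tsum_eq_iSup_nat]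
    exact iSup_le fun J => hH0 ▸ (le_add_self.trans (hsum J))
  refine ENNReal.tendsto_atTop_zero_of_tsum_ne_top fun h => ?_
  rw [h, ENNReal.mul_top (pow_ne_zero n h0)] at htsum
  exact absurd htsum (by simp)

theorem expect_le_measure_losses {W : ℕ → PMF ℕ} (ha : ∀ j, Measurable (a j))
    (hi : iIndepFun a P) (hπ : ∀ j x, P {ω | a j ω = x} = π x) (h0 : π 0 ≠ 0) (n : ℕ)
    (hW : ∀ m (f : ℕ → ℝ≥0∞), Monotone f → expect (W m) f ≤ ∑' x, π x * excursion W m x f)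
    (k : ℕ) :
    (W n).toMeasure (Set.Ici k)
      ≤ P {ω | (k : ℕ∞) ≤ ⨆ J : ℕ,
          ((∑ j ∈ Finset.range J, lossesIn n (fun i => a i ω) j : ℕ) : ℕ∞)} := by
  set f : ℕ → ℝ≥0∞ := fun x => if k ≤ x then 1 else 0 with hfdef
  have hf : Monotone f := by
    intro x y hxy
    simp only [hfdef]
    split_ifs with h1 h2
    · exact le_rfl
    · omega
    · exact zero_le
    · exact le_rfl
  set E : Set Ω := {ω | (k : ℕ∞) ≤ ⨆ J : ℕ,
          ((∑ j ∈ Finset.range J, lossesIn n (fun i => a i ω) j : ℕ) : ℕ∞)} with hE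
  -- The potential: the expected value of `f` if the future losses had the law `lossesFrom W n`. Its
  -- mean does not decrease in `J`. It is at most `1`, and once the system is empty it equals `f` at
  -- the losses so far.
  set Γ : ℕ × ℕ → ℝ≥0∞ := fun z => expect (lossesFrom W n z.1) fun y => f (y + z.2) with hΓ
  have hpot : ∀ z : ℕ × ℕ, z.1 ≤ n + 1 → Γ z ≤ ∑' x, π x * Γ (queueStep n z x) := by
    rintro ⟨_ | j, l⟩ hle
    · simp [queueStep, ENNReal.tsum_mul_right]
    · simp only [queueStep, Nat.succ_ne_zero, if_false, hΓ]
      refine (expect_lossesFrom_le hW (by simpa using hle) fun y z hyz => hf (by gcongr)).trans ?_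
      refine ENNReal.tsum_le_tsum fun x => ?_
      simp only [add_comm, add_left_comm]
      exact le_rfl
  have hstep : ∀ J, ∫⁻ ω, Γ (queueState n (fun i => a i ω) J) ∂P
      ≤ ∫⁻ ω, Γ (queueState n (fun i => a i ω) (J + 1)) ∂P := by
    intro J
    rw [lintegral_queueState_succ ha hi hπ]
    exact lintegral_mono fun ω => hpot _ (systemSize_le n _ J)
  have hmono : ∀ J, ∫⁻ ω, Γ (queueState n (fun i => a i ω) 0) ∂P
      ≤ ∫⁻ ω, Γ (queueState n (fun i => a i ω) J) ∂P := fun J =>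
    (monotone_nat_of_le_succ hstep) (Nat.zero_le J)
  have hstart : ∫⁻ ω, Γ (queueState n (fun i => a i ω) 0) ∂P = (W n).toMeasure (Set.Ici k) := by
    simp [hΓ, queueState, systemSize, lossesFrom, pure_zero_conv, hfdef, expect_indicator]
  have hbound : ∀ J, (W n).toMeasure (Set.Ici k)
      ≤ P E + P {ω | systemSize n (fun i => a i ω) J ≠ 0} := by
    intro J
    rw [← hstart]
    refine (hmono J).trans ?_
    have hmE : MeasurableSet {ω | k ≤ (queueState n (fun i => a i ω) J).2} :=
      (measurable_queueState ha n J) (Set.to_countable {z : ℕ × ℕ | k ≤ z.2}).measurableSet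
    have hmS : MeasurableSet {ω | systemSize n (fun i => a i ω) J ≠ 0} :=
      (measurable_queueState ha n J) (Set.to_countable {z : ℕ × ℕ | z.1 ≠ 0}).measurableSet
    calc ∫⁻ ω, Γ (queueState n (fun i => a i ω) J) ∂P
        ≤ ∫⁻ ω, ({ω | k ≤ (queueState n (fun i => a i ω) J).2}.indicator 1 ω
            + {ω | systemSize n (fun i => a i ω) J ≠ 0}.indicator 1 ω) ∂P := by
          refine lintegral_mono fun ω => ?_
          by_cases hz : systemSize n (fun i => a i ω) J = 0
          · simp only [hΓ, queueState, hz, lossesFrom, expect_pure, zero_add, hfdef]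
            refine le_add_right ?_
            by_cases hk : k ≤ ∑ j ∈ Finset.range J, lossesIn n (fun i => a i ω) j <;> simp [hk]
          · refine le_add_left ?_
            rw [Set.indicator_of_mem (by exact hz), Pi.one_apply, ← expect_const (lossesFrom W n
              (queueState n (fun i => a i ω) J).1) 1]
            refine expect_mono _ fun y => ?_
            simp only [hfdef]
            split_ifs <;> simp
      _ = P {ω | k ≤ (queueState n (fun i => a i ω) J).2}
            + P {ω | systemSize n (fun i => a i ω) J ≠ 0} := by
          rw [lintegral_add_left (measurable_one.indicator hmE), lintegral_indicator_one hmE,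
            lintegral_indicator_one hmS]
      _ ≤ _ := by
          gcongr
          intro ω hω
          refine le_trans ?_ (le_iSup (fun J : ℕ =>
            ((∑ j ∈ Finset.range J, lossesIn n (fun i => a i ω) j : ℕ) : ℕ∞)) J)
          exact_mod_cast hω
  have hlim := (tendsto_measure_systemSize_ne_zero ha hi hπ h0 n).const_add (P E)
  rw [add_zero] at hlim
  exact ge_of_tendsto' hlim hbound

end Chain

/-! ### The numbers of arrivals in successive services are i.i.d. -/

lemma map_pi_eq_of_joint {Ω : Type*} [MeasurableSpace Ω] {P : Measure Ω} [IsProbabilityMeasure P]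
    {J : ℕ} {f : Fin J → Ω → ℕ} (hf : ∀ i, Measurable (f i)) {ρ : Measure ℕ}
    [IsProbabilityMeasure ρ]
    (h : ∀ m : Fin J → ℕ, P {ω | ∀ i, f i ω = m i} = ∏ i, ρ {m i}) :
    P.map (fun ω i => f i ω) = Measure.pi fun _ : Fin J => ρ := by
  refine Measure.ext_of_singleton fun m => ?_
  rw [Measure.map_apply (measurable_pi_lambda _ hf) (measurableSet_singleton m),
    Measure.pi_singleton, ← h]
  congr 1
  ext ω
  simp [funext_iff]

lemma map_eq_of_joint {Ω : Type*} [MeasurableSpace Ω] {P : Measure Ω} [IsProbabilityMeasure P]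
    {J : ℕ} {f : Fin J → Ω → ℕ} (hf : ∀ i, Measurable (f i)) {ρ : Measure ℕ}
    [IsProbabilityMeasure ρ]
    (h : ∀ m : Fin J → ℕ, P {ω | ∀ i, f i ω = m i} = ∏ i, ρ {m i}) (i : Fin J) :
    P.map (f i) = ρ := by
  have h1 := (measurePreserving_eval (fun _ : Fin J => ρ) i).map_eq
  rw [← map_pi_eq_of_joint hf h, Measure.map_map (measurable_pi_apply i)
    (measurable_pi_lambda _ hf)] at h1
  exact h1

/-- Initial segments suffice, since every finite index set lies in one. -/
lemma iIndepFun_of_joint {Ω : Type*} [MeasurableSpace Ω] {P : Measure Ω} [IsProbabilityMeasure P]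
    {f : ℕ → Ω → ℕ} (hf : ∀ i, Measurable (f i)) {ρ : Measure ℕ} [IsProbabilityMeasure ρ]
    (h : ∀ (J : ℕ) (m : Fin J → ℕ), P {ω | ∀ i : Fin J, f i ω = m i} = ∏ i, ρ {m i}) :
    iIndepFun f P := by
  have hJ : ∀ J : ℕ, iIndepFun (fun (i : Fin J) => f (i : ℕ)) P := fun J => by
    rw [iIndepFun_iff_map_fun_eq_pi_map fun i : Fin J => (hf i).aemeasurable,
      map_pi_eq_of_joint (fun i : Fin J => hf i) (h J)]
    congr 1
    funext i
    exact (map_eq_of_joint (fun i : Fin J => hf i) (h J) i).symm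
  refine iIndepFun_iff_finset.2 fun s => ?_
  exact iIndepFun.precomp
    (g := fun x : s => (⟨x.1, Nat.lt_add_one_of_le (Finset.le_sup (f := id) x.2)⟩ :
      Fin (s.sup id + 1)))
    (fun x y hxy => Subtype.ext (by simpa using hxy)) (hJ _)

/-- An event about `Y` with a countably valued random parameter `X` independent of `Y`. -/
lemma measure_mem_of_indepFun {Ω ι β : Type*} [MeasurableSpace Ω] [MeasurableSpace β]
    [MeasurableSpace ι] [Countable ι] [MeasurableSingletonClass ι] {P : Measure Ω}
    [IsProbabilityMeasure P] {X : Ω → ι} {Y : Ω → β} (hX : Measurable X) (hY : Measurable Y)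
    (h : IndepFun X Y P) {A : ι → Set β} (hA : ∀ i, MeasurableSet (A i)) :
    P {ω | Y ω ∈ A (X ω)} = ∫⁻ ω, P (Y ⁻¹' A (X ω)) ∂P := by
  have hs : MeasurableSet {z : ι × β | z.2 ∈ A z.1} := by
    have : {z : ι × β | z.2 ∈ A z.1} = ⋃ i, {i} ×ˢ A i := by
      ext z
      simp
    rw [this]
    exact MeasurableSet.iUnion fun i => (measurableSet_singleton i).prod (hA i)
  have h1 : P {ω | Y ω ∈ A (X ω)} = P.map (fun ω => (X ω, Y ω)) {z : ι × β | z.2 ∈ A z.1} := by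
    rw [Measure.map_apply (hX.prodMk hY) hs]
    rfl
  rw [h1, (indepFun_iff_map_prod_eq_prod_map_map hX.aemeasurable hY.aemeasurable).1 h,
    Measure.prod_apply hs, lintegral_map (measurable_of_countable _) hX]
  refine lintegral_congr fun ω => ?_
  exact Measure.map_apply hY (hA _)

/-- Law of the number of points of a Poisson process of rate `lam` in an independent interval
whose length has law `B`. -/
noncomputable def arrivalLaw (lam : ℝ) (B : Measure ℝ) [IsProbabilityMeasure B] : PMF ℕ :=
  ⟨fun m => ∫⁻ x, poissonMeasure (lam.toNNReal * x.toNNReal) {m} ∂B, by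
    have hm : ∀ m : ℕ, Measurable fun x : ℝ =>
        poissonMeasure (lam.toNNReal * x.toNNReal) {m} := fun m => by
      simp_rw [poissonMeasure_singleton]
      fun_prop
    rw [ENNReal.summable.hasSum_iff, ← lintegral_tsum fun m => (hm m).aemeasurable]
    have : ∀ x : ℝ, ∑' m : ℕ, poissonMeasure (lam.toNNReal * x.toNNReal) {m} = 1 := fun x => by
      have h := lintegral_countable' (μ := poissonMeasure (lam.toNNReal * x.toNNReal)) fun _ => 1
      simp only [lintegral_const, measure_univ, one_mul] at h
      exact h.symm
    simp [this]⟩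

lemma measurable_poissonMeasure_singleton (lam : ℝ≥0) (m : ℕ) :
    Measurable fun x : ℝ≥0 => poissonMeasure (lam * x) {m} := by
  simp_rw [poissonMeasure_singleton]
  fun_prop

lemma continuous_poissonMeasure_singleton (lam : ℝ≥0) (m : ℕ) :
    Continuous fun x : ℝ≥0 => poissonMeasure (lam * x) {m} := by
  simp_rw [poissonMeasure_singleton]
  refine ENNReal.continuous_ofReal.comp ?_
  fun_prop

/-! ### Random service ends approximated by grid points -/

section Arrivals

variable {Ω : Type*} [MeasurableSpace Ω] {P : Measure Ω} {lam : ℝ} {B : Measure ℝ}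
  {N : ℝ≥0 → Ω → ℕ} {χ : ℕ → Ω → ℝ≥0}

/-- The least multiple of `1 / (r + 1)` that is at least `t`, as an index of the grid. -/
noncomputable def gridIndex (r : ℕ) (t : ℝ≥0) : ℕ := ⌈((r : ℝ≥0) + 1) * t⌉₊

/-- Points of the grid of mesh `1 / (r + 1)`. -/
noncomputable def gridPoint (r k : ℕ) : ℝ≥0 := k / ((r : ℝ≥0) + 1)

lemma gridPoint_mono (r : ℕ) : Monotone (gridPoint r) := fun a b h => by
  unfold gridPoint
  gcongr

lemma gridIndex_mono (r : ℕ) : Monotone (gridIndex r) := fun a b h => by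
  unfold gridIndex
  gcongr

lemma le_gridPoint (r : ℕ) (t : ℝ≥0) : t ≤ gridPoint r (gridIndex r t) := by
  unfold gridPoint gridIndex
  rw [le_div_iff₀ (by positivity), mul_comm]
  exact Nat.le_ceil _

lemma gridPoint_le (r : ℕ) (t : ℝ≥0) : gridPoint r (gridIndex r t) ≤ t + 1 / ((r : ℝ≥0) + 1) := by
  unfold gridPoint gridIndex
  have h : (r : ℝ≥0) + 1 ≠ 0 := by positivity
  rw [div_le_iff₀ (by positivity), add_mul t, one_div, inv_mul_cancel₀ h, mul_comm t]
  exact (Nat.ceil_lt_add_one (zero_le)).le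

lemma tendsto_gridPoint (t : ℝ≥0) :
    Filter.Tendsto (fun r => gridPoint r (gridIndex r t)) Filter.atTop (nhds t) := by
  refine tendsto_of_tendsto_of_tendsto_of_le_of_le tendsto_const_nhds ?_
    (fun r => le_gridPoint r t) fun r => gridPoint_le r t
  have h : Filter.Tendsto (fun r : ℕ => 1 / ((r : ℝ≥0) + 1)) Filter.atTop (nhds 0) :=
    tendsto_one_div_add_atTop_nhds_zero_nat
  simpa using h.const_add t

lemma measurable_gridIndex (r : ℕ) : Measurable (gridIndex r) :=
  Nat.measurable_ceil.comp (measurable_const.mul measurable_id)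

lemma serviceStart_mono (c : ℕ → ℝ≥0) : Monotone (serviceStart c) := fun _ _ h =>
  Finset.sum_le_sum_of_subset (Finset.range_mono h)

lemma measurable_serviceStart (j : ℕ) : Measurable fun c : ℕ → ℝ≥0 => serviceStart c j := by
  unfold serviceStart
  fun_prop

/-- `arrivalsIn`, with the ends of the service rounded up to the grid. -/
noncomputable def gridArrivals (N : ℝ≥0 → ℕ) (c : ℕ → ℝ≥0) (r j : ℕ) : ℕ :=
  N (gridPoint r (gridIndex r (serviceStart c (j + 1))))
    - N (gridPoint r (gridIndex r (serviceStart c j)))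

/-- Rounding up keeps the approximating times to the right of the service ends, where a
right-continuous integer path is locally constant. -/
lemma eventually_gridArrivals_eq {N : ℝ≥0 → ℕ}
    (hN : ∀ t, ContinuousWithinAt N (Set.Ici t) t) (c : ℕ → ℝ≥0) (j : ℕ) :
    ∀ᶠ r in Filter.atTop, gridArrivals N c r j = arrivalsIn N c j := by
  have h : ∀ t, ∀ᶠ r in Filter.atTop, N (gridPoint r (gridIndex r t)) = N t := fun t => by
    have h1 := hN t
    rw [ContinuousWithinAt, nhds_discrete, Filter.tendsto_pure] at h1
    exact (tendsto_nhdsWithin_iff.2 ⟨tendsto_gridPoint t,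
      Filter.Eventually.of_forall fun r => le_gridPoint r t⟩).eventually h1
  filter_upwards [h (serviceStart c (j + 1)), h (serviceStart c j)] with r h1 h2
  rw [gridArrivals, arrivalsIn, h1, h2]

lemma measure_increments_eq (hN : IsPoissonProcess P lam N) {J : ℕ} {t : Fin (J + 1) → ℝ≥0}
    (ht : Monotone t) (m : Fin J → ℕ) :
    P {ω | ∀ i : Fin J, N (t i.succ) ω - N (t i.castSucc) ω = m i}
      = ∏ i : Fin J, poissonMeasure (lam.toNNReal * (t i.succ - t i.castSucc)) {m i} := by
  have h := (hN.indep J t ht).measure_inter_preimage_eq_mul Finset.univ (sets := fun i => {m i})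
    fun i _ => measurableSet_singleton _
  have e : {ω | ∀ i : Fin J, N (t i.succ) ω - N (t i.castSucc) ω = m i}
      = ⋂ i ∈ (Finset.univ : Finset (Fin J)),
        (fun ω => N (t i.succ) ω - N (t i.castSucc) ω) ⁻¹' {m i} := by
    ext ω
    simp
  rw [e, h]
  refine Finset.prod_congr rfl fun i _ => ?_
  have hm : Measurable fun ω => N (t i.succ) ω - N (t i.castSucc) ω :=
    (hN.measurable _).sub (hN.measurable _)
  rw [← hN.law _ _ (ht i.castSucc_lt_succ.le), Measure.map_apply hm (measurableSet_singleton _)]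

lemma measurable_comp_nat {Y : ℕ → Ω → ℕ} (hY : ∀ k, Measurable (Y k)) {K : Ω → ℕ}
    (hK : Measurable K) : Measurable fun ω => Y (K ω) ω := by
  have h1 : Measurable fun z : ℕ × Ω => Y z.1 z.2 := measurable_from_prod_countable_right hY
  exact h1.comp (hK.prodMk measurable_id)

lemma measurable_gridArrivals (hQ : IsMGIInput P lam B N χ) (r j : ℕ) :
    Measurable fun ω => gridArrivals (fun t => N t ω) (fun i => χ i ω) r j := by
  have hχ : Measurable fun ω j => χ j ω := measurable_pi_lambda _ hQ.service_measurable
  have h2 : ∀ i, Measurable fun ω => gridIndex r (serviceStart (fun i => χ i ω) i) := fun i =>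
    (measurable_gridIndex r).comp ((measurable_serviceStart i).comp hχ)
  have h3 := fun i => measurable_comp_nat (fun k => hQ.poisson.measurable (gridPoint r k)) (h2 i)
  unfold gridArrivals
  exact (h3 (j + 1)).sub (h3 j)

lemma measurable_arrivalsIn (hQ : IsMGIInput P lam B N χ) (j : ℕ) :
    Measurable fun ω => arrivalsIn (fun t => N t ω) (fun i => χ i ω) j := by
  refine measurable_of_tendsto_metrizable (fun r => measurable_gridArrivals hQ r j)
    (tendsto_pi_nhds.2 fun ω => ?_)
  rw [nhds_discrete, Filter.tendsto_pure]
  exact eventually_gridArrivals_eq (hQ.poisson.rightCont ω) _ j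

variable [IsProbabilityMeasure P]

/-- Rounded service ends have countably many values and are independent of `N`. With them frozen,
only increments of `N` at deterministic times remain. -/
lemma measure_gridArrivals (hQ : IsMGIInput P lam B N χ) (J r : ℕ) (m : Fin J → ℕ) :
    P {ω | ∀ i : Fin J, gridArrivals (fun t => N t ω) (fun j => χ j ω) r i = m i}
      = ∫⁻ ω, ∏ i : Fin J, poissonMeasure (lam.toNNReal *
          (gridPoint r (gridIndex r (serviceStart (fun j => χ j ω) (i + 1)))
            - gridPoint r (gridIndex r (serviceStart (fun j => χ j ω) i)))) {m i} ∂P := by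
  set φ : (ℕ → ℝ≥0) → Fin (J + 1) → ℕ := fun c i => gridIndex r (serviceStart c i) with hφ
  have hφm : Measurable φ := measurable_pi_lambda _ fun i =>
    (measurable_gridIndex r).comp (measurable_serviceStart _)
  have hχ : Measurable fun ω j => χ j ω := measurable_pi_lambda _ hQ.service_measurable
  have hNm : Measurable fun ω t => N t ω := measurable_pi_lambda _ hQ.poisson.measurable
  set A : (Fin (J + 1) → ℕ) → Set (ℝ≥0 → ℕ) := fun κ => {y | ∀ i : Fin J,
    y (gridPoint r (κ i.succ)) - y (gridPoint r (κ i.castSucc)) = m i} with hA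
  have hAm : ∀ κ, MeasurableSet (A κ) := fun κ => by
    have : A κ = ⋂ i : Fin J, (fun y : ℝ≥0 → ℕ =>
        y (gridPoint r (κ i.succ)) - y (gridPoint r (κ i.castSucc))) ⁻¹' {m i} := by
      ext y
      simp [hA]
    rw [this]
    refine MeasurableSet.iInter fun i => Measurable.sub ?_ ?_ (measurableSet_singleton _) <;>
      exact measurable_pi_apply _
  have hind : IndepFun (fun ω => φ fun j => χ j ω) (fun ω t => N t ω) P :=
    hQ.input_indep.symm.comp hφm measurable_id
  have h := measure_mem_of_indepFun (hφm.comp hχ) hNm hind hAm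
  have e : {ω | ∀ i : Fin J, gridArrivals (fun t => N t ω) (fun j => χ j ω) r i = m i}
      = {ω | (fun t => N t ω) ∈ A (φ fun j => χ j ω)} := by
    ext ω
    simp [hA, hφ, gridArrivals]
  rw [e]
  refine h.trans (lintegral_congr fun ω => ?_)
  have hmono : Monotone fun i : Fin (J + 1) => gridPoint r (φ (fun j => χ j ω) i) :=
    fun i j hij => gridPoint_mono r (gridIndex_mono r (serviceStart_mono _ hij))
  have h2 := measure_increments_eq hQ.poisson hmono m
  simpa [hφ, hA] using h2

lemma measure_arrivalsIn (hQ : IsMGIInput P lam B N χ) (J : ℕ) (m : Fin J → ℕ) :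
    P {ω | ∀ i : Fin J, arrivalsIn (fun t => N t ω) (fun j => χ j ω) i = m i}
      = ∫⁻ ω, ∏ i : Fin J, poissonMeasure (lam.toNNReal * χ i ω) {m i} ∂P := by
  have hχ : Measurable fun ω j => χ j ω := measurable_pi_lambda _ hQ.service_measurable
  have hset : ∀ f : Fin J → Ω → ℕ, (∀ i, Measurable (f i)) →
      MeasurableSet {ω | ∀ i, f i ω = m i} := fun f hf => by
    rw [Set.ofPred_forall]
    exact MeasurableSet.iInter fun i => hf i (measurableSet_singleton _)
  have h1 : Filter.Tendsto (fun r => ∫⁻ ω, {ω | ∀ i : Fin J,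
        gridArrivals (fun t => N t ω) (fun j => χ j ω) r i = m i}.indicator 1 ω ∂P) Filter.atTop
      (nhds (∫⁻ ω, {ω | ∀ i : Fin J,
        arrivalsIn (fun t => N t ω) (fun j => χ j ω) i = m i}.indicator 1 ω ∂P)) := by
    refine tendsto_lintegral_of_dominated_convergence (fun _ => 1)
      (fun r => measurable_one.indicator (hset _ fun i => measurable_gridArrivals hQ r i))
      (fun r => Filter.Eventually.of_forall fun ω => Set.indicator_le_self' (by simp) ω)
      (by simp) (Filter.Eventually.of_forall fun ω => ?_)
    refine tendsto_const_nhds.congr' ?_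
    filter_upwards [Filter.eventually_all.2 fun i : Fin J =>
      eventually_gridArrivals_eq (hQ.poisson.rightCont ω) (fun j => χ j ω) i] with r hr
    simp only [Set.indicator, Set.mem_ofPred_eq, hr]
    congr
  have h2 : Filter.Tendsto (fun r => ∫⁻ ω, ∏ i : Fin J, poissonMeasure (lam.toNNReal *
          (gridPoint r (gridIndex r (serviceStart (fun j => χ j ω) (i + 1)))
            - gridPoint r (gridIndex r (serviceStart (fun j => χ j ω) i)))) {m i} ∂P) Filter.atTop
      (nhds (∫⁻ ω, ∏ i : Fin J, poissonMeasure (lam.toNNReal * χ i ω) {m i} ∂P)) := by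
    have hg : ∀ r i, Measurable fun ω =>
        gridPoint r (gridIndex r (serviceStart (fun i => χ i ω) i)) := fun r i =>
      (measurable_of_countable (gridPoint r)).comp
        ((measurable_gridIndex r).comp ((measurable_serviceStart i).comp hχ))
    refine tendsto_lintegral_of_dominated_convergence (fun _ => 1)
      (fun r => Finset.measurable_prod _ fun i _ =>
        (measurable_poissonMeasure_singleton _ _).comp ((hg r _).sub (hg r _)))
      (fun r => Filter.Eventually.of_forall fun ω => Finset.prod_le_one' fun i _ => prob_le_one)
      (by simp) (Filter.Eventually.of_forall fun ω => ?_)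
    refine ENNReal.tendsto_finsetProd_of_ne_top _ (fun i _ => ?_) fun i _ => measure_ne_top _ _
    have hlim := (tendsto_gridPoint (serviceStart (fun j => χ j ω) (i + 1))).sub
      (tendsto_gridPoint (serviceStart (fun j => χ j ω) i))
    have hdiff : serviceStart (fun j => χ j ω) (i + 1) - serviceStart (fun j => χ j ω) i
        = χ i ω := by
      rw [serviceStart, Finset.sum_range_succ]
      exact add_tsub_cancel_left _ _
    rw [hdiff] at hlim
    exact ((continuous_poissonMeasure_singleton _ _).tendsto _).comp hlim
  have h3 := tendsto_nhds_unique (h1.congr fun r => ?_) h2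
  · rw [← h3, lintegral_indicator_one (hset _ fun i => measurable_arrivalsIn hQ i)]
  · rw [lintegral_indicator_one (hset _ fun i => measurable_gridArrivals hQ r i),
      measure_gridArrivals hQ]

/-- Given the services, the counts are independent Poisson variables, the `j`-th depending on `χ j`
alone. Independence of the `χ j` then factors the integral of the product. -/
theorem arrivalsIn_iid [IsProbabilityMeasure B] (hQ : IsMGIInput P lam B N χ) :
    iIndepFun (fun j ω => arrivalsIn (fun t => N t ω) (fun i => χ i ω) j) P ∧
      ∀ j x, P {ω | arrivalsIn (fun t => N t ω) (fun i => χ i ω) j = x} = arrivalLaw lam B x := by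
  have hm := measurable_arrivalsIn hQ
  have hone : ∀ i x, ∫⁻ ω, poissonMeasure (lam.toNNReal * χ i ω) {x} ∂P = arrivalLaw lam B x := by
    intro i x
    show _ = ∫⁻ t, poissonMeasure (lam.toNNReal * t.toNNReal) {x} ∂B
    rw [← hQ.service_law i, lintegral_map]
    · simp
    · exact (measurable_poissonMeasure_singleton _ x).comp measurable_real_toNNReal
    · exact measurable_coe_nnreal_real.comp (hQ.service_measurable i)
  have h : ∀ (J : ℕ) (m : Fin J → ℕ),
      P {ω | ∀ i : Fin J, arrivalsIn (fun t => N t ω) (fun j => χ j ω) i = m i}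
        = ∏ i, (arrivalLaw lam B).toMeasure {m i} := by
    intro J m
    rw [measure_arrivalsIn hQ]
    have hi : iIndepFun (fun i : Fin J => χ i) P := hQ.service_indep.precomp Fin.val_injective
    have hi' := hi.comp (fun i x => poissonMeasure (lam.toNNReal * x) {m i})
      fun i => measurable_poissonMeasure_singleton _ _
    refine (lintegral_prod_eq_prod_lintegral_of_indepFun Finset.univ _ hi' fun i =>
      (measurable_poissonMeasure_singleton _ _).comp (hQ.service_measurable i)).trans ?_
    refine Finset.prod_congr rfl fun i _ => ?_
    rw [PMF.toMeasure_apply_singleton _ _ (measurableSet_singleton _), ← hone i]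
    rfl
  refine ⟨iIndepFun_of_joint hm h, fun j x => ?_⟩
  have h2 := map_eq_of_joint (fun i : Fin (j + 1) => hm i) (h (j + 1)) (Fin.last j)
  rw [← PMF.toMeasure_apply_singleton _ _ (measurableSet_singleton _), ← h2,
    Measure.map_apply (hm _) (measurableSet_singleton _)]
  rfl

end Arrivals

/-! ### Erlang densities and mixed Poisson tails -/

/-- Density of the Erlang distribution with shape `k + 1` and rate `lam`. -/
noncomputable def erlang (lam : ℝ) (k : ℕ) (x : ℝ) : ℝ :=
  lam * (Real.exp (-lam * x) * (lam * x) ^ k / (k.factorial : ℝ))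

/-- Tail of the Erlang distribution with shape `k` and rate `lam`. -/
noncomputable def erlangTail (lam : ℝ) (k : ℕ) (x : ℝ) : ℝ :=
  ∑ j ∈ Finset.range k, Real.exp (-lam * x) * (lam * x) ^ j / (j.factorial : ℝ)

lemma erlang_nonneg {lam : ℝ} (hlam : 0 < lam) (k : ℕ) {x : ℝ} (hx : 0 ≤ x) :
    0 ≤ erlang lam k x := by
  unfold erlang
  positivity

lemma continuous_erlang (lam : ℝ) (k : ℕ) : Continuous (erlang lam k) := by
  unfold erlang
  fun_prop

/-- The derivatives of the successive Poisson weights telescope, leaving only the last term. -/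
lemma hasDerivAt_erlangTail (lam : ℝ) (k : ℕ) (x : ℝ) :
    HasDerivAt (erlangTail lam (k + 1)) (-erlang lam k x) x := by
  have hexp : HasDerivAt (fun x => Real.exp (-lam * x)) (Real.exp (-lam * x) * (-lam)) x := by
    simpa using ((hasDerivAt_id x).const_mul (-lam)).exp
  induction k with
  | zero =>
    have e : erlangTail lam (0 + 1) = fun x => Real.exp (-lam * x) := by
      funext x
      simp [erlangTail]
    rw [e]
    convert! hexp using 1
    simp [erlang]
    ring
  | succ k ih =>
    have e : erlangTail lam (k + 1 + 1) = fun x => erlangTail lam (k + 1) x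
        + Real.exp (-lam * x) * (lam * x) ^ (k + 1) / ((k + 1).factorial : ℝ) := by
      funext x
      unfold erlangTail
      rw [Finset.sum_range_succ]
    rw [e]
    have hpow : HasDerivAt (fun x => (lam * x) ^ (k + 1)) ((k + 1) * (lam * x) ^ k * lam) x := by
      simpa using ((hasDerivAt_id x).const_mul lam).fun_pow (k + 1)
    convert! ih.add ((hexp.mul hpow).div_const _) using 1
    simp only [erlang, Nat.factorial_succ, Nat.cast_mul, Nat.cast_succ]
    have hk : (k.factorial : ℝ) ≠ 0 := by positivity
    have hk1 : (k : ℝ) + 1 ≠ 0 := by positivity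
    field_simp
    ring

lemma erlangTail_zero (lam : ℝ) (k : ℕ) : erlangTail lam (k + 1) 0 = 1 := by
  unfold erlangTail
  rw [Finset.sum_range_succ']
  simp

lemma integral_erlang (lam : ℝ) (k : ℕ) (z : ℝ) :
    ∫ x in (0 : ℝ)..z, erlang lam k x = 1 - erlangTail lam (k + 1) z := by
  have h := intervalIntegral.integral_eq_sub_of_hasDerivAt (a := 0) (b := z)
    (fun x _ => (hasDerivAt_erlangTail lam k x).neg)
    ((continuous_erlang lam k).neg.neg.intervalIntegrable 0 z)
  simp only [neg_neg, Pi.neg_apply, erlangTail_zero] at h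
  rw [h]
  ring

lemma tendsto_erlangTail {lam : ℝ} (hlam : 0 < lam) (k : ℕ) :
    Filter.Tendsto (erlangTail lam k) Filter.atTop (nhds 0) := by
  have h : ∀ j, Filter.Tendsto (fun x => Real.exp (-lam * x) * (lam * x) ^ j / (j.factorial : ℝ))
      Filter.atTop (nhds 0) := fun j => by
    have h1 := (Real.tendsto_pow_mul_exp_neg_atTop_nhds_zero j).comp
      (Filter.tendsto_id.const_mul_atTop hlam)
    have h2 := h1.div_const (j.factorial : ℝ)
    rw [zero_div] at h2
    refine h2.congr fun x => ?_
    simp [mul_comm]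
  have h' := tendsto_finsetSum (Finset.range k) fun j _ => h j
  rw [Finset.sum_const_zero] at h'
  exact h'

lemma integrableOn_erlang {lam : ℝ} (hlam : 0 < lam) (k : ℕ) :
    IntegrableOn (erlang lam k) (Set.Ioi 0) := by
  have h := integrableOn_Ioi_deriv_of_nonpos' (a := 0) (l := 0)
    (fun x _ => hasDerivAt_erlangTail lam k x)
    (fun x hx => neg_nonpos.2 (erlang_nonneg hlam k (Set.mem_Ioi.1 hx).le))
    (tendsto_erlangTail hlam (k + 1))
  simpa using h.neg

lemma integral_Ioi_erlang {lam : ℝ} (hlam : 0 < lam) (k : ℕ) :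
    ∫ x in Set.Ioi 0, erlang lam k x = 1 := by
  have h := integral_Ioi_of_hasDerivAt_of_nonpos' (a := 0) (l := 0)
    (fun x _ => hasDerivAt_erlangTail lam k x)
    (fun x hx => neg_nonpos.2 (erlang_nonneg hlam k (Set.mem_Ioi.1 hx).le))
    (tendsto_erlangTail hlam (k + 1))
  rw [integral_neg, erlangTail_zero] at h
  linarith

/-- A Beta integral; each integration by parts moves one power from `z - y` to `y`. -/
lemma integral_pow_mul_pow (z : ℝ) (k m : ℕ) :
    ∫ y in (0 : ℝ)..z, y ^ k / (k.factorial : ℝ) * ((z - y) ^ m / (m.factorial : ℝ))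
      = z ^ (k + m + 1) / ((k + m + 1).factorial : ℝ) := by
  induction m generalizing k with
  | zero =>
    have h : ∀ y : ℝ, y ^ k / (k.factorial : ℝ) * ((z - y) ^ 0 / (Nat.factorial 0 : ℝ))
        = y ^ k / (k.factorial : ℝ) := fun y => by simp
    simp_rw [h]
    rw [intervalIntegral.integral_div, integral_pow, add_zero, Nat.factorial_succ, Nat.cast_mul,
      zero_pow (Nat.succ_ne_zero k), sub_zero, div_div, Nat.cast_succ]
  | succ m ih =>
    have hd : ∀ y : ℝ, HasDerivAt (fun y => y ^ (k + 1) / ((k + 1).factorial : ℝ)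
          * ((z - y) ^ (m + 1) / ((m + 1).factorial : ℝ)))
        (y ^ k / (k.factorial : ℝ) * ((z - y) ^ (m + 1) / ((m + 1).factorial : ℝ))
          - y ^ (k + 1) / ((k + 1).factorial : ℝ) * ((z - y) ^ m / (m.factorial : ℝ))) y := by
      intro y
      have h1 : HasDerivAt (fun y : ℝ => y ^ (k + 1)) ((k + 1) * y ^ k) y := by
        simpa using hasDerivAt_pow (k + 1) y
      have h2 : HasDerivAt (fun y : ℝ => (z - y) ^ (m + 1)) ((m + 1) * (z - y) ^ m * (-1)) y := by
        simpa using ((hasDerivAt_id y).const_sub z).fun_pow (m + 1)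
      convert! (h1.div_const ((k + 1).factorial : ℝ)).mul
        (h2.div_const ((m + 1).factorial : ℝ)) using 1
      simp only [Nat.factorial_succ, Nat.cast_mul, Nat.cast_succ]
      have hk : (k.factorial : ℝ) ≠ 0 := by positivity
      have hk1 : (k : ℝ) + 1 ≠ 0 := by positivity
      have hm : (m.factorial : ℝ) ≠ 0 := by positivity
      have hm1 : (m : ℝ) + 1 ≠ 0 := by positivity
      field_simp
      ring
    have h := intervalIntegral.integral_eq_sub_of_hasDerivAt (a := 0) (b := z)
      (fun y _ => hd y) (Continuous.intervalIntegrable (by fun_prop) 0 z)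
    rw [intervalIntegral.integral_sub (Continuous.intervalIntegrable (by fun_prop) 0 z)
      (Continuous.intervalIntegrable (by fun_prop) 0 z), ih (k + 1)] at h
    simp only [sub_self, ne_eq, Nat.succ_ne_zero, not_false_eq_true, zero_pow, zero_div, mul_zero,
      zero_mul] at h
    rw [sub_eq_zero.1 h, show k + 1 + m + 1 = k + (m + 1) + 1 by ring]

/-- Shapes add under convolution. The index is the shape minus one, whence `k + m + 1`. -/
lemma integral_erlang_mul_erlang (lam : ℝ) (k m : ℕ) (z : ℝ) :
    ∫ y in (0 : ℝ)..z, erlang lam k y * erlang lam m (z - y) = erlang lam (k + m + 1) z := by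
  have h : ∀ y, erlang lam k y * erlang lam m (z - y)
      = lam ^ (k + m + 2) * Real.exp (-lam * z)
        * (y ^ k / (k.factorial : ℝ) * ((z - y) ^ m / (m.factorial : ℝ))) := by
    intro y
    have he : Real.exp (-lam * z) = Real.exp (-lam * y) * Real.exp (-lam * (z - y)) := by
      rw [← Real.exp_add]
      ring_nf
    rw [he]
    unfold erlang
    rw [mul_pow, mul_pow]
    ring
  simp_rw [h]
  rw [intervalIntegral.integral_const_mul, integral_pow_mul_pow]
  unfold erlang
  rw [mul_pow]
  ring

/-- The Erlang density on the whole line. -/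
noncomputable def erlangLine (lam : ℝ) (k : ℕ) : ℝ → ℝ := (Set.Ioi 0).indicator (erlang lam k)

lemma integrable_erlangLine {lam : ℝ} (hlam : 0 < lam) (k : ℕ) :
    Integrable (erlangLine lam k) :=
  (integrable_indicator_iff measurableSet_Ioi).2 (integrableOn_erlang hlam k)

lemma integral_erlangLine_mul (lam : ℝ) (k m : ℕ) (z : ℝ) :
    ∫ y, erlangLine lam k y * erlangLine lam m (z - y) = erlangLine lam (k + m + 1) z := by
  have h : ∀ y, erlangLine lam k y * erlangLine lam m (z - y)
      = (Set.Ioo 0 z).indicator (fun y => erlang lam k y * erlang lam m (z - y)) y := by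
    intro y
    unfold erlangLine
    by_cases h1 : 0 < y <;> by_cases h2 : y < z <;> simp [Set.indicator, h1, h2]
  simp_rw [h]
  rw [integral_indicator measurableSet_Ioo]
  unfold erlangLine
  rcases le_or_gt z 0 with hz | hz
  · rw [Set.Ioo_eq_empty (not_lt.2 hz), Set.indicator_of_notMem (by simpa using hz)]
    simp
  · rw [Set.indicator_of_mem (by exact hz), ← integral_erlang_mul_erlang,
      intervalIntegral.integral_of_le hz.le, integral_Ioc_eq_integral_Ioo]

lemma setIntegral_eq_erlangLine (lam : ℝ) (k : ℕ) (S : ℝ → ℝ) :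
    ∫ x in Set.Ioi 0, erlang lam k x * S x = ∫ x, S x * erlangLine lam k x := by
  rw [← integral_indicator measurableSet_Ioi]
  refine integral_congr_ae (Filter.Eventually.of_forall fun x => ?_)
  by_cases hx : 0 < x <;> simp [erlangLine, Set.indicator, hx, mul_comm]

lemma integrable_mul_of_mem_Icc {α : Type*} [MeasurableSpace α] {μ : Measure α} {f S : α → ℝ}
    (hf : Integrable f μ) (hS : Measurable S) (h0 : ∀ x, 0 ≤ S x) (h1 : ∀ x, S x ≤ 1) :
    Integrable (fun x => S x * f x) μ :=
  hf.bdd_mul hS.aestronglyMeasurable (c := 1) (Filter.Eventually.of_forall fun x => by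
    rw [Real.norm_eq_abs, abs_of_nonneg (h0 x)]
    exact h1 x)

/-- A lower bound on the Erlang integrals of the shifts of `S` propagates to convolutions. -/
lemma mul_integral_erlang_le {lam : ℝ} (hlam : 0 < lam) {S : ℝ → ℝ} (hS : Measurable S)
    (h0 : ∀ x, 0 ≤ S x) (h1 : ∀ x, S x ≤ 1) {c : ℝ} {m : ℕ}
    (hc : ∀ y, 0 < y → c * S y ≤ ∫ x in Set.Ioi 0, erlang lam m x * S (x + y)) (k : ℕ) :
    c * ∫ y in Set.Ioi 0, erlang lam k y * S y
      ≤ ∫ z in Set.Ioi 0, erlang lam (k + m + 1) z * S z := by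
  have hk := integrable_erlangLine hlam k
  have hm := integrable_erlangLine hlam m
  have hint : Integrable (Function.uncurry fun z y =>
      S z * (erlangLine lam k y * erlangLine lam m (z - y))) (volume.prod volume) :=
    integrable_mul_of_mem_Icc
      (hk.convolution_integrand (ContinuousLinearMap.mul ℝ ℝ) hm)
      (hS.comp measurable_fst) (fun _ => h0 _) fun _ => h1 _
  -- The Erlang time `z` is split into the time `y` of the first `k + 1` points and the further time
  -- `x` of `m + 1` points.
  have hswap : ∫ z in Set.Ioi 0, erlang lam (k + m + 1) z * S z
      = ∫ y in Set.Ioi 0, erlang lam k y * ∫ x in Set.Ioi 0, erlang lam m x * S (x + y) := by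
    rw [setIntegral_eq_erlangLine, setIntegral_eq_erlangLine]
    simp_rw [← integral_erlangLine_mul lam k m, ← integral_const_mul]
    rw [integral_integral_swap hint]
    refine integral_congr_ae (Filter.Eventually.of_forall fun y => ?_)
    simp only
    rw [setIntegral_eq_erlangLine lam m fun x => S (x + y), ← integral_mul_const]
    rw [← integral_add_right_eq_self
      (fun z => S z * (erlangLine lam k y * erlangLine lam m (z - y))) y]
    refine integral_congr_ae (Filter.Eventually.of_forall fun z => ?_)
    simp only [add_sub_cancel_right]
    ring
  rw [hswap, ← integral_const_mul]
  have hi2 := (hint.integral_prod_right).integrableOn (s := Set.Ioi 0)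
  refine setIntegral_mono_on ?_ ?_ measurableSet_Ioi fun y hy => ?_
  · refine Integrable.const_mul ?_ c
    have := integrable_mul_of_mem_Icc (integrableOn_erlang hlam k) hS h0 h1
    exact this.congr (Filter.Eventually.of_forall fun y => mul_comm _ _)
  · refine hi2.congr ?_
    filter_upwards [self_mem_ae_restrict measurableSet_Ioi] with y hy
    simp only [Function.uncurry]
    rw [setIntegral_eq_erlangLine lam m fun x => S (x + y), ← integral_const_mul,
      ← integral_add_right_eq_self
        (fun z => S z * (erlangLine lam k y * erlangLine lam m (z - y))) y]
    refine integral_congr_ae (Filter.Eventually.of_forall fun z => ?_)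
    simp only [add_sub_cancel_right]
    rw [erlangLine, Set.indicator_of_mem hy]
    ring
  · have := mul_le_mul_of_nonneg_left (hc y hy) (erlang_nonneg hlam k (Set.mem_Ioi.1 hy).le)
    linarith

/-- Mixed Poisson tails as Erlang integrals of the survival function. -/
lemma one_sub_sum_mixedPoisson {lam : ℝ} (hlam : 0 < lam) (μ : Measure ℝ) [IsProbabilityMeasure μ]
    (hμ : μ (Set.Iio 0) = 0) (k : ℕ) :
    1 - ∑ j ∈ Finset.range (k + 1), ∫ x in Set.Ici (0 : ℝ),
        Real.exp (-lam * x) * (lam * x) ^ j / (j.factorial : ℝ) ∂μ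
      = ∫ x in Set.Ioi 0, erlang lam k x * (1 - cdf μ x) := by
  have hres : μ.restrict (Set.Ici 0) = μ := by
    rw [Measure.restrict_eq_self_of_ae_mem]
    rw [ae_iff]
    convert! hμ using 2
    ext x
    simp
  have hnn : ∀ᵐ x ∂μ, (0 : ℝ) ≤ x := by
    rw [ae_iff]
    convert! hμ using 2
    ext x
    simp
  have hint : ∀ j : ℕ, Integrable (fun x : ℝ =>
      Real.exp (-lam * x) * (lam * x) ^ j / (j.factorial : ℝ)) μ := fun j => by
    refine Integrable.of_bound (C := 1) (by fun_prop) ?_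
    filter_upwards [hnn] with x hx
    rw [Real.norm_eq_abs, abs_of_nonneg (by positivity), mul_div_assoc]
    have h1 := Real.pow_div_factorial_le_exp (lam * x) (by positivity) j
    calc Real.exp (-lam * x) * ((lam * x) ^ j / (j.factorial : ℝ))
        ≤ Real.exp (-lam * x) * Real.exp (lam * x) := by gcongr
      _ = 1 := by rw [← Real.exp_add]; simp
  have hprod : Integrable (Function.uncurry fun z x : ℝ =>
      (Set.Iio z).indicator (erlang lam k) x) (μ.prod (volume.restrict (Set.Ioi 0))) := by
    have h1 : Integrable (fun p : ℝ × ℝ => erlang lam k p.2)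
        (μ.prod (volume.restrict (Set.Ioi 0))) := (integrableOn_erlang hlam k).comp_snd μ
    have h2 := h1.indicator (measurableSet_lt measurable_snd measurable_fst)
    refine h2.congr (Filter.Eventually.of_forall fun p => ?_)
    simp only [Function.uncurry, Set.indicator, Set.mem_Iio, Set.mem_ofPred_eq]
  rw [hres, ← integral_finsetSum _ fun j _ => hint j]
  calc 1 - ∫ x, ∑ j ∈ Finset.range (k + 1),
        Real.exp (-lam * x) * (lam * x) ^ j / (j.factorial : ℝ) ∂μ
      = ∫ z, (1 - erlangTail lam (k + 1) z) ∂μ := by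
        simp only [erlangTail]
        rw [integral_sub (integrable_const _) (integrable_finsetSum _ fun j _ => hint j)]
        simp
    -- More than `k` Poisson points in an interval of length `z` means that the point number `k +
    -- 1`, with density `erlang lam k`, comes before `z`.
    _ = ∫ z, (∫ x in Set.Ioi 0, (Set.Iio z).indicator (erlang lam k) x) ∂μ := by
        refine integral_congr_ae ?_
        filter_upwards [hnn] with z hz
        rw [setIntegral_indicator measurableSet_Iio, Set.Ioi_inter_Iio,
          ← integral_Ioc_eq_integral_Ioo, ← intervalIntegral.integral_of_le hz, integral_erlang]
    _ = ∫ x in Set.Ioi 0, (∫ z, (Set.Iio z).indicator (erlang lam k) x ∂μ) :=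
        integral_integral_swap hprod
    _ = ∫ x in Set.Ioi 0, erlang lam k x * (1 - cdf μ x) := by
        refine integral_congr_ae (Filter.Eventually.of_forall fun x => ?_)
        have e : (fun z => (Set.Iio z).indicator (erlang lam k) x)
            = (Set.Ioi x).indicator fun _ => erlang lam k x := by
          funext z
          simp [Set.indicator]
        simp only [e]
        rw [integral_indicator_const _ measurableSet_Ioi, smul_eq_mul, mul_comm, cdf_eq_real,
          ← Set.compl_Iic, probReal_compl_eq_one_sub measurableSet_Iic]

lemma toReal_tail_eq_one_sub (s : PMF ℕ) (k : ℕ) :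
    (tail s k).toReal = 1 - ∑ j ∈ Finset.range k, (s j).toReal := by
  induction k with
  | zero => simp [tail_zero]
  | succ k ih =>
    have h := congrArg ENNReal.toReal (tail_succ s k)
    rw [ENNReal.toReal_add (s.apply_ne_top k)
      ((tail_le_one s _).trans_lt ENNReal.one_lt_top).ne, ih] at h
    rw [Finset.sum_range_succ]
    linarith

lemma IsMixedPoisson.toReal_tail {lam : ℝ} (hlam : 0 < lam) {μ : Measure ℝ}
    [IsProbabilityMeasure μ] (hμ : μ (Set.Iio 0) = 0) {s : PMF ℕ} (hs : IsMixedPoisson lam μ s)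
    (k : ℕ) :
    (tail s (k + 1)).toReal = ∫ x in Set.Ioi 0, erlang lam k x * (1 - cdf μ x) := by
  rw [toReal_tail_eq_one_sub, ← one_sub_sum_mixedPoisson hlam μ hμ]
  exact congrArg (1 - ·) (Finset.sum_congr rfl fun j _ => hs j)

lemma isMixedPoisson_arrivalLaw {lam : ℝ} (hlam : 0 < lam) (B : Measure ℝ)
    [IsProbabilityMeasure B] (hB : B (Set.Iio 0) = 0) :
    IsMixedPoisson lam B (arrivalLaw lam B) := by
  intro m
  have hres : B.restrict (Set.Ici 0) = B := by
    rw [Measure.restrict_eq_self_of_ae_mem]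
    rw [ae_iff]
    convert! hB using 2
    ext x
    simp
  have e : arrivalLaw lam B m
      = ∫⁻ x in Set.Ici 0, poissonMeasure (lam.toNNReal * x.toNNReal) {m} ∂B := by
    rw [hres]
    rfl
  rw [e, integral_eq_lintegral_of_nonneg_ae]
  · congr 1
    refine setLIntegral_congr_fun measurableSet_Ici fun x hx => ?_
    have hx' : (0 : ℝ) ≤ x := hx
    rw [poissonMeasure_singleton]
    simp [hlam.le, hx', mul_pow]
  · filter_upwards [self_mem_ae_restrict measurableSet_Ici] with x hx
    have hx' : (0 : ℝ) ≤ x := hx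
    simp only [Pi.zero_apply]
    positivity
  · exact Measurable.aestronglyMeasurable (by fun_prop)

/-! ### Survival functions with almost memoryless residuals -/

lemma integral_shift (S : ℝ → ℝ) (x : ℝ) :
    ∫ y in Set.Ioi 0, S (x + y) = ∫ t in Set.Ioi x, S t := by
  have h := (measurePreserving_add_left volume x).setIntegral_preimage_emb
    (measurableEmbedding_addLeft x) S (Set.Ioi x)
  rw [← h]
  simp

lemma integrableOn_shift {S : ℝ → ℝ} (h : IntegrableOn S (Set.Ioi 0)) {x : ℝ} (hx : 0 ≤ x) :
    IntegrableOn (fun y => S (x + y)) (Set.Ioi 0) := by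
  have h1 := (measurePreserving_add_left volume x).integrableOn_comp_preimage
    (measurableEmbedding_addLeft x) (f := S) (s := Set.Ioi x)
  simp only [Set.preimage_const_add_Ioi, sub_self] at h1
  exact h1.2 (h.mono_set (Set.Ioi_subset_Ioi hx))

lemma intervalIntegrable_of_Ioi {S : ℝ → ℝ} (h : IntegrableOn S (Set.Ioi 0)) {x y : ℝ}
    (hx : 0 ≤ x) (hxy : x ≤ y) : IntervalIntegrable S volume x y := by
  rw [intervalIntegrable_iff_integrableOn_Ioc_of_le hxy]
  exact h.mono_set fun t ht => hx.trans_lt ht.1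

lemma interval_add_Ioi {S : ℝ → ℝ} (h : IntegrableOn S (Set.Ioi 0)) {x y : ℝ}
    (hx : 0 ≤ x) (hxy : x ≤ y) :
    (∫ t in x..y, S t) + ∫ t in Set.Ioi y, S t = ∫ t in Set.Ioi x, S t :=
  intervalIntegral.integral_interval_add_Ioi (h.mono_set (Set.Ioi_subset_Ioi hx))
    (h.mono_set (Set.Ioi_subset_Ioi (hx.trans hxy)))

/-- If the residual at `y₀` has the least mean `a`, comparison of this residual with `S` on
`[0, T]` bounds `a` from below. -/
lemma le_of_minimal_residual {S w : ℝ → ℝ} (hS : IntegrableOn S (Set.Ioi 0)) (hw : Continuous w)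
    (hclose : ∀ x y, 0 ≤ x → 0 ≤ y → |S (x + y) - S x * S y| ≤ w x * S y)
    {a y₀ T : ℝ} (ha : 0 ≤ a) (hy₀ : 0 ≤ y₀) (hT : 0 ≤ T) (hpos : 0 < S y₀)
    (hmin : ∀ y, 0 ≤ y → a * S y ≤ ∫ t in Set.Ioi y, S t)
    (heq : ∫ t in Set.Ioi y₀, S t = a * S y₀) :
    (∫ x in (0 : ℝ)..T, S x) - (∫ x in (0 : ℝ)..T, w x) + a * (S T - w T) ≤ a := by
  have hSi := intervalIntegrable_of_Ioi hS le_rfl hT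
  have hwi := hw.intervalIntegrable (μ := volume) 0 T
  -- The integral beyond `y₀` is cut at `y₀ + T`. On the first piece `S (x + y₀)` is compared with
  -- `S x * S y₀`; on the second, minimality of `a` is used and then closeness at `T`.
  have h1 := interval_add_Ioi hS hy₀ (le_add_of_nonneg_right hT)
  have h2 : ∫ t in y₀..(y₀ + T), S t = ∫ x in (0 : ℝ)..T, S (x + y₀) := by
    rw [intervalIntegral.integral_comp_add_right, zero_add, add_comm T]
  have hshift : IntervalIntegrable (fun x => S (x + y₀)) volume 0 T := by
    have := intervalIntegrable_of_Ioi (integrableOn_shift hS hy₀) le_rfl hT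
    simpa only [add_comm y₀] using this
  have h3 : ∫ x in (0 : ℝ)..T, (S x - w x) * S y₀ ≤ ∫ x in (0 : ℝ)..T, S (x + y₀) := by
    refine intervalIntegral.integral_mono_on hT ((hSi.sub hwi).mul_const _) hshift fun x hx => ?_
    have := (abs_le.1 (hclose x y₀ hx.1 hy₀)).1
    linarith
  rw [intervalIntegral.integral_mul_const, intervalIntegral.integral_sub hSi hwi] at h3
  have h4 := hmin (y₀ + T) (by positivity)
  have h5 : (S T - w T) * S y₀ ≤ S (y₀ + T) := by
    have := (abs_le.1 (hclose T y₀ hT hy₀)).1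
    rw [add_comm y₀]
    linarith
  have h6 := mul_le_mul_of_nonneg_left h5 ha
  refine le_of_mul_le_mul_right ?_ hpos
  rw [h2] at h1
  linarith

/-- `S` is a nonnegative, nonincreasing, integrable function with integral `m` whose residuals
`S (· + y) / S y` differ from `S` by at most `d`. -/
structure AlmostMemoryless (S : ℝ → ℝ) (m d : ℝ) : Prop where
  antitone : AntitoneOn S (Set.Ici 0)
  nonneg : ∀ x, 0 ≤ x → 0 ≤ S x
  integrableOn : IntegrableOn S (Set.Ioi 0)
  integral : ∫ x in Set.Ioi 0, S x = m
  pos : 0 < m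
  dev_nonneg : 0 ≤ d
  close : ∀ x y, 0 ≤ x → 0 ≤ y → |S (x + y) - S x * S y| ≤ d * S y

namespace AlmostMemoryless

variable {S : ℝ → ℝ} {m d : ℝ}

/-- The integrated tail of `S` is close to a multiple of `S`. -/
lemma abs_integral_Ioi_sub_le (h : AlmostMemoryless S m d) {x : ℝ} (hx : 0 ≤ x) :
    |(∫ t in Set.Ioi x, S t) - m * S x| ≤ d * m := by
  have e : (∫ t in Set.Ioi x, S t) - m * S x = ∫ y in Set.Ioi 0, (S (x + y) - S x * S y) := by
    rw [integral_sub (integrableOn_shift h.integrableOn hx) (h.integrableOn.const_mul _),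
      integral_const_mul, h.integral, integral_shift, mul_comm m]
  have e' : d * m = ∫ y in Set.Ioi 0, d * S y := by rw [integral_const_mul, h.integral]
  rw [e, e', ← Real.norm_eq_abs]
  refine MeasureTheory.norm_integral_le_of_norm_le (h.integrableOn.const_mul d) ?_
  filter_upwards [self_mem_ae_restrict measurableSet_Ioi] with y hy
  exact h.close x y hx (Set.mem_Ioi.1 hy).le

/-- With `V` the integrated tail, monotonicity gives `V x ≥ V (x + m/2) + (m/2) S (x + m/2)`, and
closeness gives `m S (x + m/2) ≥ V (x + m/2) - d m`. Together these give decay by the factor `2/3`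
down to the level `d m`. -/
lemma integral_Ioi_step (h : AlmostMemoryless S m d) {x : ℝ} (hx : 0 ≤ x) :
    (∫ t in Set.Ioi (x + m / 2), S t) - d * m ≤ 2 / 3 * ((∫ t in Set.Ioi x, S t) - d * m) := by
  have hm := h.pos
  have h1 := interval_add_Ioi h.integrableOn hx (le_add_of_nonneg_right (half_pos hm).le)
  have h2 : ∫ t in x..(x + m / 2), S (x + m / 2) ≤ ∫ t in x..(x + m / 2), S t := by
    refine intervalIntegral.integral_mono_on (by linarith) intervalIntegrable_const
      (intervalIntegrable_of_Ioi h.integrableOn hx (by linarith)) fun t ht => ?_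
    exact h.antitone (hx.trans ht.1) (Set.mem_Ici.2 (by positivity)) ht.2
  rw [intervalIntegral.integral_const, add_sub_cancel_left, smul_eq_mul] at h2
  have h3 := (abs_le.1 (h.abs_integral_Ioi_sub_le (x := x + m / 2) (by positivity))).2
  linarith

/-- Upper bound on the integrated tail. -/
lemma integral_Ioi_le (h : AlmostMemoryless S m d) :
    ∫ t in Set.Ioi (3 / 2 * m), S t ≤ m * (d + (1 - d) * (8 / 27)) := by
  have hm := h.pos
  have h1 := h.integral_Ioi_step le_rfl
  have h2 := h.integral_Ioi_step (x := 0 + m / 2) (by positivity)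
  have h3 := h.integral_Ioi_step (x := 0 + m / 2 + m / 2) (by positivity)
  rw [h.integral] at h1
  -- Three steps of length `m / 2` starting from `V 0 = m`; hence `(2/3)^3 = 8/27`.
  rw [show 3 / 2 * m = 0 + m / 2 + m / 2 + m / 2 by ring]
  linarith

/-- If the residual at `y₀` has the least mean `a`, then `a ≥ (1 - 5 d) m`. -/
lemma le_of_minimal (h : AlmostMemoryless S m d) {a y₀ : ℝ} (ha : 0 ≤ a) (hy₀ : 0 ≤ y₀)
    (hpos : 0 < S y₀) (hmin : ∀ y, 0 ≤ y → a * S y ≤ ∫ t in Set.Ioi y, S t)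
    (heq : ∫ t in Set.Ioi y₀, S t = a * S y₀) : (1 - 5 * d) * m ≤ a := by
  have hm := h.pos
  have hd := h.dev_nonneg
  have hT : (0 : ℝ) ≤ 3 / 2 * m := by positivity
  have h1 := le_of_minimal_residual (w := fun _ => d) (T := 3 / 2 * m) h.integrableOn
    continuous_const h.close ha hy₀ hT hpos hmin heq
  have h2 := interval_add_Ioi h.integrableOn le_rfl hT
  rw [h.integral] at h2
  have h3 := (abs_le.1 (h.abs_integral_Ioi_sub_le hT)).2
  have h4 := h.integral_Ioi_le
  simp only [intervalIntegral.integral_const, sub_zero, smul_eq_mul] at h1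
  obtain ⟨v, hv⟩ : ∃ v, ∫ t in Set.Ioi (3 / 2 * m), S t = m * v :=
    ⟨(∫ t in Set.Ioi (3 / 2 * m), S t) / m, by rw [mul_comm m, div_mul_cancel₀ _ hm.ne']⟩
  rw [hv] at h2 h3 h4
  have h5 : v ≤ d + (1 - d) * (8 / 27) := le_of_mul_le_mul_left h4 hm
  have h6 : v - d ≤ S (3 / 2 * m) := by
    refine le_of_mul_le_mul_left ?_ hm
    linarith
  have h7 := mul_le_mul_of_nonneg_left h6 ha
  -- The constant `5` in `1 - 5 d` comes from here. The two sides of `h8` differ in their brackets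
  -- by `(3/2 + 2) d = 7/2 d`, and `5 * (7/10) = 7/2`. The choice `T = 3/2 m` suffices because `1 -
  -- 8/27 > 7/10`.
  have hQ : 7 / 10 ≤ 1 - v + 2 * d := by linarith
  have h8 : m * (1 - v - 3 / 2 * d) ≤ a * (1 - v + 2 * d) := by linarith
  have h9 : (1 - 5 * d) * m * (1 - v + 2 * d) ≤ m * (1 - v - 3 / 2 * d) := by
    have := mul_le_mul_of_nonneg_left hQ (mul_nonneg hm.le hd)
    linarith
  exact le_of_mul_le_mul_right (h9.trans h8) (by linarith)

lemma integrableOn_damped (h : AlmostMemoryless S m d) {lam : ℝ} (hlam : 0 < lam) :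
    IntegrableOn (fun x => Real.exp (-lam * x) * S x) (Set.Ioi 0) := by
  refine h.integrableOn.bdd_mul (c := 1)
    (Continuous.aestronglyMeasurable (by fun_prop)) ?_
  filter_upwards [self_mem_ae_restrict measurableSet_Ioi] with x hx
  rw [Real.norm_eq_abs, Real.abs_exp, Real.exp_le_one_iff]
  nlinarith [Set.mem_Ioi.1 hx]

lemma integral_damped_pos (h : AlmostMemoryless S m d) {lam : ℝ} (hlam : 0 < lam) :
    0 < ∫ x in Set.Ioi 0, Real.exp (-lam * x) * S x := by
  have hnn : 0 ≤ᵐ[volume.restrict (Set.Ioi 0)] fun x => Real.exp (-lam * x) * S x := by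
    filter_upwards [self_mem_ae_restrict measurableSet_Ioi] with x hx
    exact mul_nonneg (Real.exp_pos _).le (h.nonneg x (Set.mem_Ioi.1 hx).le)
  refine lt_of_le_of_ne (integral_nonneg_of_ae hnn) fun h0 => h.pos.ne ?_
  have h1 := (integral_eq_zero_iff_of_nonneg_ae hnn (h.integrableOn_damped hlam)).1 h0.symm
  rw [← h.integral, eq_comm]
  refine integral_eq_zero_of_ae ?_
  filter_upwards [h1] with x hx
  exact (mul_eq_zero.1 hx).resolve_left (Real.exp_pos _).ne'

/-- Exponential factors are multiplicative and at most `1`, so damping does not increase the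
deviation. Results about means thereby become results about Laplace transforms. -/
lemma damped (h : AlmostMemoryless S m d) {lam : ℝ} (hlam : 0 < lam) :
    AlmostMemoryless (fun x => Real.exp (-lam * x) * S x)
      (∫ x in Set.Ioi 0, Real.exp (-lam * x) * S x) d where
  antitone := fun x hx y hy hxy => by
    refine mul_le_mul (Real.exp_le_exp.2 ?_) (h.antitone hx hy hxy) (h.nonneg y hy)
      (Real.exp_pos _).le
    nlinarith
  nonneg := fun x hx => mul_nonneg (Real.exp_pos _).le (h.nonneg x hx)
  integrableOn := h.integrableOn_damped hlam
  integral := rfl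
  pos := h.integral_damped_pos hlam
  dev_nonneg := h.dev_nonneg
  close := fun x y hx hy => by
    have e : Real.exp (-lam * (x + y)) * S (x + y)
          - Real.exp (-lam * x) * S x * (Real.exp (-lam * y) * S y)
        = Real.exp (-lam * x) * (Real.exp (-lam * y) * (S (x + y) - S x * S y)) := by
      rw [mul_add, Real.exp_add]
      ring
    rw [e, abs_mul, abs_mul, Real.abs_exp, Real.abs_exp]
    have h1 : Real.exp (-lam * x) ≤ 1 := Real.exp_le_one_iff.2 (by nlinarith)
    have h2 := mul_le_mul_of_nonneg_left (h.close x y hx hy) (Real.exp_pos (-lam * y)).le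
    calc Real.exp (-lam * x) * (Real.exp (-lam * y) * |S (x + y) - S x * S y|)
        ≤ 1 * (Real.exp (-lam * y) * |S (x + y) - S x * S y|) := by gcongr
      _ ≤ d * (Real.exp (-lam * y) * S y) := by linarith

lemma integral_exp_weight (lam a b : ℝ) :
    ∫ x in a..b, lam * Real.exp (-lam * x) = Real.exp (-lam * a) - Real.exp (-lam * b) := by
  have hd : ∀ x : ℝ, HasDerivAt (fun x => -Real.exp (-lam * x)) (lam * Real.exp (-lam * x)) x :=
    fun x => by
      convert! (((hasDerivAt_id x).const_mul (-lam)).exp).neg using 1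
      simp
      ring
  rw [intervalIntegral.integral_eq_sub_of_hasDerivAt (fun x _ => hd x)
    (Continuous.intervalIntegrable (by fun_prop) _ _)]
  ring

lemma integral_exp_mul_primitive {lam T : ℝ} (hS : IntegrableOn S (Set.Ioi 0)) (hT : 0 ≤ T) :
    ∫ x in (0 : ℝ)..T, lam * Real.exp (-lam * x) * ∫ t in (0 : ℝ)..x, S t
      = ∫ t in (0 : ℝ)..T, S t * (Real.exp (-lam * t) - Real.exp (-lam * T)) := by
  have hSi : IntegrableOn S (Set.Ioc 0 T) := hS.mono_set Set.Ioc_subset_Ioi_self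
  have hφ : IntegrableOn (fun x => lam * Real.exp (-lam * x)) (Set.Ioc 0 T) :=
    (Continuous.integrableOn_Icc (by fun_prop)).mono_set Set.Ioc_subset_Icc_self
  have hint : Integrable (Function.uncurry fun x t : ℝ =>
      (Set.Iic x).indicator (fun t => lam * Real.exp (-lam * x) * S t) t)
      ((volume.restrict (Set.Ioc 0 T)).prod (volume.restrict (Set.Ioc 0 T))) := by
    refine ((hφ.mul_prod hSi).indicator (measurableSet_le measurable_snd measurable_fst)).congr
      (Filter.Eventually.of_forall fun p => ?_)
    simp only [Function.uncurry, Set.indicator, Set.mem_Iic, Set.mem_ofPred_eq]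
  have hswap := integral_integral_swap hint
  rw [intervalIntegral.integral_of_le hT, intervalIntegral.integral_of_le hT]
  calc ∫ x in Set.Ioc 0 T, lam * Real.exp (-lam * x) * ∫ t in (0 : ℝ)..x, S t
      = ∫ x in Set.Ioc 0 T, (∫ t in Set.Ioc 0 T,
          (Set.Iic x).indicator (fun t => lam * Real.exp (-lam * x) * S t) t) := by
        refine setIntegral_congr_fun measurableSet_Ioc fun x hx => ?_
        rw [setIntegral_indicator measurableSet_Iic, Set.Ioc_inter_Iic, min_eq_right hx.2,
          integral_const_mul, intervalIntegral.integral_of_le hx.1.le]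
    _ = ∫ t in Set.Ioc 0 T, (∫ x in Set.Ioc 0 T,
          (Set.Iic x).indicator (fun t => lam * Real.exp (-lam * x) * S t) t) := hswap
    _ = _ := by
        refine setIntegral_congr_fun measurableSet_Ioc fun t ht => ?_
        have e : (fun x => (Set.Iic x).indicator (fun t => lam * Real.exp (-lam * x) * S t) t)
            = (Set.Ici t).indicator fun x => S t * (lam * Real.exp (-lam * x)) := by
          funext x
          simp [Set.indicator, mul_comm]
        have hset : Set.Ioc 0 T ∩ Set.Ici t = Set.Icc t T := by
          ext x
          simp only [Set.mem_inter_iff, Set.mem_Ioc, Set.mem_Ici, Set.mem_Icc]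
          exact ⟨fun hx => ⟨hx.2, hx.1.2⟩, fun hx => ⟨⟨ht.1.trans_le hx.1, hx.2⟩, hx.1⟩⟩
        simp only [e]
        rw [setIntegral_indicator measurableSet_Ici, hset, integral_Icc_eq_integral_Ioc,
          integral_const_mul, ← intervalIntegral.integral_of_le ht.2, integral_exp_weight]

/-- Comparison of the damped integral of `S` with that of its integrated tail. -/
lemma abs_damped_integral_le (h : AlmostMemoryless S m d) {lam T : ℝ} (hlam : 0 < lam)
    (hT : 0 ≤ T) :
    |m - (∫ x in (0 : ℝ)..T, Real.exp (-lam * x) * S x) * (1 + lam * m)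
      - Real.exp (-lam * T) * ∫ t in Set.Ioi T, S t| ≤ d * m * (1 - Real.exp (-lam * T)) := by
  set V : ℝ → ℝ := fun x => ∫ t in Set.Ioi x, S t with hV
  have hSi := intervalIntegrable_of_Ioi h.integrableOn le_rfl hT
  have hprim : ∀ x, 0 ≤ x → (∫ t in (0 : ℝ)..x, S t) = m - V x := fun x hx => by
    have := interval_add_Ioi h.integrableOn le_rfl hx
    rw [h.integral] at this
    linarith
  have hVi : IntervalIntegrable V volume 0 T := by
    refine AntitoneOn.intervalIntegrable fun x hx y hy hxy => ?_
    rw [Set.uIcc_of_le hT] at hx hy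
    exact setIntegral_mono_set (h.integrableOn.mono_set (Set.Ioi_subset_Ioi hx.1))
      (by
        filter_upwards [self_mem_ae_restrict measurableSet_Ioi] with t ht
        exact h.nonneg t (hx.1.trans (Set.mem_Ioi.1 ht).le))
      (Set.Ioi_subset_Ioi hxy).eventuallyLE
  have hφV : IntervalIntegrable (fun x => lam * Real.exp (-lam * x) * V x) volume 0 T :=
    hVi.continuousOn_mul (Continuous.continuousOn (by fun_prop))
  have hφS : IntervalIntegrable (fun x => lam * Real.exp (-lam * x) * S x) volume 0 T :=
    hSi.continuousOn_mul (Continuous.continuousOn (by fun_prop))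
  have heS : IntervalIntegrable (fun x => Real.exp (-lam * x) * S x) volume 0 T :=
    hSi.continuousOn_mul (Continuous.continuousOn (by fun_prop))
  have hφ : IntervalIntegrable (fun x => lam * Real.exp (-lam * x)) volume 0 T :=
    Continuous.intervalIntegrable (by fun_prop) _ _
  have h1 : ∫ x in (0 : ℝ)..T, lam * Real.exp (-lam * x) * V x
      = m - (∫ x in (0 : ℝ)..T, Real.exp (-lam * x) * S x) - Real.exp (-lam * T) * V T := by
    have h2 := integral_exp_mul_primitive (lam := lam) h.integrableOn hT
    have h3 : ∫ x in (0 : ℝ)..T, lam * Real.exp (-lam * x) * ∫ t in (0 : ℝ)..x, S t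
        = ∫ x in (0 : ℝ)..T, (lam * Real.exp (-lam * x) * m - lam * Real.exp (-lam * x) * V x) := by
      refine intervalIntegral.integral_congr fun x hx => ?_
      rw [Set.uIcc_of_le hT] at hx
      rw [hprim x hx.1]
      ring
    have h4 : ∫ t in (0 : ℝ)..T, S t * (Real.exp (-lam * t) - Real.exp (-lam * T))
        = ∫ t in (0 : ℝ)..T, (Real.exp (-lam * t) * S t - Real.exp (-lam * T) * S t) := by
      congr 1
      funext t
      ring
    rw [h3, h4, intervalIntegral.integral_sub (hφ.mul_const m) hφV,
      intervalIntegral.integral_sub heS (hSi.const_mul _), intervalIntegral.integral_mul_const,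
      integral_exp_weight, intervalIntegral.integral_const_mul, hprim T hT] at h2
    simp only [mul_zero, Real.exp_zero] at h2
    linarith
  -- This integral of `V - m S` against `lam * exp (-lam x)` would vanish for an exactly memoryless
  -- `S`. The pointwise bound `d m` on `V - m S` therefore controls it.
  have h5 : ∫ x in (0 : ℝ)..T, (lam * Real.exp (-lam * x) * V x
        - lam * Real.exp (-lam * x) * S x * m)
      = m - (∫ x in (0 : ℝ)..T, Real.exp (-lam * x) * S x) * (1 + lam * m)
        - Real.exp (-lam * T) * V T := by
    rw [intervalIntegral.integral_sub hφV (hφS.mul_const m), h1,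
      intervalIntegral.integral_mul_const]
    simp_rw [mul_assoc lam]
    rw [intervalIntegral.integral_const_mul]
    ring
  rw [← h5, ← Real.norm_eq_abs]
  refine (intervalIntegral.norm_integral_le_of_norm_le hT
    (g := fun x => lam * Real.exp (-lam * x) * (d * m)) (Filter.Eventually.of_forall fun x hx => ?_)
    (hφ.mul_const _)).trans_eq ?_
  · have h6 := h.abs_integral_Ioi_sub_le hx.1.le
    rw [show lam * Real.exp (-lam * x) * V x - lam * Real.exp (-lam * x) * S x * m
      = lam * Real.exp (-lam * x) * (V x - m * S x) by ring, Real.norm_eq_abs, abs_mul,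
      abs_of_nonneg (by positivity : 0 ≤ lam * Real.exp (-lam * x))]
    exact mul_le_mul_of_nonneg_left h6 (by positivity)
  · rw [intervalIntegral.integral_mul_const, integral_exp_weight]
    simp
    ring

/-- The damped integral of `S` is close to that of the exponential law with the same mean. -/
lemma damped_integral_le (h : AlmostMemoryless S m d) {lam : ℝ} (hlam : 0 < lam) :
    (∫ x in Set.Ioi 0, Real.exp (-lam * x) * S x) * (1 + lam * m) ≤ m * (1 + d) := by
  have hm := h.pos
  have hi := h.integrableOn_damped hlam
  refine le_of_tendsto ((intervalIntegral_tendsto_integral_Ioi 0 hi Filter.tendsto_id).mul_const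
    (1 + lam * m)) ?_
  filter_upwards [Filter.eventually_ge_atTop 0] with T hT
  have h1 := (abs_le.1 (h.abs_damped_integral_le hlam hT)).1
  have h2 : 0 ≤ Real.exp (-lam * T) * ∫ t in Set.Ioi T, S t :=
    mul_nonneg (Real.exp_pos _).le (setIntegral_nonneg measurableSet_Ioi fun t ht =>
      h.nonneg t (hT.trans (Set.mem_Ioi.1 ht).le))
  have h3 : d * m * (1 - Real.exp (-lam * T)) ≤ d * m := by
    have := mul_nonneg (mul_nonneg h.dev_nonneg hm.le) (Real.exp_pos (-lam * T)).le
    linarith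
  simp only [id]
  linarith

/-- If the residual at `y₀` has the least damped integral `a`, then `a` is not much less than
the damped integral of the exponential survival function with the same mean as `S`. -/
lemma le_damped_of_minimal (h : AlmostMemoryless S m d) {lam a y₀ : ℝ} (hlam : 0 < lam)
    (ha : 0 ≤ a) (hy₀ : 0 ≤ y₀) (hpos : 0 < S y₀)
    (hmin : ∀ y, 0 ≤ y → a * (Real.exp (-lam * y) * S y)
      ≤ ∫ t in Set.Ioi y, Real.exp (-lam * t) * S t)
    (heq : ∫ t in Set.Ioi y₀, Real.exp (-lam * t) * S t
      = a * (Real.exp (-lam * y₀) * S y₀)) :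
    (1 - 5 * d) * m ≤ a * (1 + lam * m) := by
  have hm := h.pos
  have hd := h.dev_nonneg
  have hT : (0 : ℝ) ≤ 3 / 2 * m := by positivity
  have h1 := le_of_minimal_residual (S := fun x => Real.exp (-lam * x) * S x)
    (w := fun x => d * Real.exp (-lam * x)) (T := 3 / 2 * m)
    (h.integrableOn_damped hlam) (by fun_prop)
    (fun x y hx hy => by
      have e : Real.exp (-lam * (x + y)) * S (x + y)
            - Real.exp (-lam * x) * S x * (Real.exp (-lam * y) * S y)
          = Real.exp (-lam * x) * (Real.exp (-lam * y) * (S (x + y) - S x * S y)) := by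
        rw [mul_add, Real.exp_add]
        ring
      rw [e, abs_mul, abs_mul, Real.abs_exp, Real.abs_exp]
      have h2 := mul_le_mul_of_nonneg_left (h.close x y hx hy) (Real.exp_pos (-lam * y)).le
      have h3 := mul_le_mul_of_nonneg_left h2 (Real.exp_pos (-lam * x)).le
      linarith)
    ha hy₀ hT (mul_pos (Real.exp_pos _) hpos) hmin heq
  have h2 := (abs_le.1 (h.abs_damped_integral_le hlam hT)).2
  have h3 := (abs_le.1 (h.abs_integral_Ioi_sub_le hT)).2
  have h4 := h.integral_Ioi_le
  have hw : lam * ∫ x in (0 : ℝ)..(3 / 2 * m), d * Real.exp (-lam * x)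
      = d * (1 - Real.exp (-lam * (3 / 2 * m))) := by
    have := integral_exp_weight lam 0 (3 / 2 * m)
    rw [intervalIntegral.integral_const_mul] at this ⊢
    simp only [mul_zero, Real.exp_zero] at this
    rw [← this]
    ring
  set T := 3 / 2 * m with hTdef
  set s := Real.exp (-lam * T) with hs
  set X := ∫ x in (0 : ℝ)..T, Real.exp (-lam * x) * S x
  set w := ∫ x in (0 : ℝ)..T, d * Real.exp (-lam * x)
  have hs0 : 0 < s := Real.exp_pos _
  have hs1 : s ≤ 1 := Real.exp_le_one_iff.2 (by nlinarith)
  have hs2 : 1 - s ≤ lam * T := by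
    have := Real.add_one_le_exp (-lam * T)
    linarith
  obtain ⟨v, hv⟩ : ∃ v, ∫ t in Set.Ioi T, S t = m * v :=
    ⟨(∫ t in Set.Ioi T, S t) / m, by rw [mul_comm m, div_mul_cancel₀ _ hm.ne']⟩
  rw [hv] at h2 h3 h4
  have h5 : v ≤ d + (1 - d) * (8 / 27) := le_of_mul_le_mul_left h4 hm
  have h6 : v - d ≤ S T := by
    refine le_of_mul_le_mul_left ?_ hm
    linarith
  have hwT : w ≤ d * T := by
    refine le_of_mul_le_mul_left ?_ hlam
    have := mul_le_mul_of_nonneg_left hs2 hd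
    linarith
  set A := a * (1 + lam * m) with hA
  have hA0 : 0 ≤ A := by positivity
  have h7 : X * (1 + lam * m) - w * (1 + lam * m) + A * (s * S T - d * s) ≤ A := by
    have := mul_le_mul_of_nonneg_right h1 (by positivity : 0 ≤ 1 + lam * m)
    linarith
  -- Scaling by `1 + lam * m` turns the exponential reference `m / (1 + lam * m)` into `m`, so that
  -- `A` is to be compared with `m` itself.
  have h8 : A * (s * (v - d)) ≤ A * (s * S T) :=
    mul_le_mul_of_nonneg_left (mul_le_mul_of_nonneg_left h6 hs0.le) hA0
  have h9 : w * (1 + lam * m) ≤ d * (3 / 2 * m) + m * (d * (1 - s)) := by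
    have : w * (1 + lam * m) = w + m * (lam * w) := by ring
    have hwT' : w ≤ d * (3 / 2 * m) := hwT
    rw [this, hw]
    linarith
  -- As in the undamped case: the discrepancy in `h12` is again `7/2 d`, and it is absorbed by `5 d
  -- * (7/10)`. Since `s ≤ 1`, damping does not weaken the lower bound `7/10`.
  have hQ : 7 / 10 ≤ 1 - s * v + 2 * d * s := by
    have h10 := mul_le_mul_of_nonneg_left h5 hs0.le
    have h11 := mul_nonneg hd hs0.le
    linarith
  have h12 : m * (1 - s * v + 2 * d * s - 7 / 2 * d) ≤ A * (1 - s * v + 2 * d * s) := by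
    linarith
  have h13 : (1 - 5 * d) * m * (1 - s * v + 2 * d * s)
      ≤ m * (1 - s * v + 2 * d * s - 7 / 2 * d) := by
    have := mul_le_mul_of_nonneg_left hQ (mul_nonneg hm.le hd)
    linarith
  exact le_of_mul_le_mul_right (h13.trans h12) (by linarith)

end AlmostMemoryless

/-! ### Survival functions and residual lives -/

/-- Survival function of the law `F`. -/
noncomputable def survival (F : Measure ℝ) (x : ℝ) : ℝ := 1 - cdf F x

lemma survival_antitone (F : Measure ℝ) : Antitone (survival F) := fun _ _ h =>
  sub_le_sub_left (monotone_cdf F h) 1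

lemma survival_nonneg (F : Measure ℝ) (x : ℝ) : 0 ≤ survival F x := sub_nonneg.2 (cdf_le_one F x)

lemma survival_le_one (F : Measure ℝ) (x : ℝ) : survival F x ≤ 1 :=
  sub_le_self _ (cdf_nonneg F x)

lemma measurable_survival (F : Measure ℝ) : Measurable (survival F) :=
  (survival_antitone F).measurable

lemma residualDF_nonneg (F : Measure ℝ) (y x : ℝ) : 0 ≤ residualDF F y x :=
  ENNReal.toReal_nonneg

section Residual

variable (F : Measure ℝ) [IsProbabilityMeasure F]

lemma real_Ioi_eq_survival (x : ℝ) : F.real (Set.Ioi x) = survival F x := by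
  rw [survival, cdf_eq_real, ← Set.compl_Iic, probReal_compl_eq_one_sub measurableSet_Iic]

lemma survival_pos_iff (x : ℝ) : 0 < survival F x ↔ F (Set.Ioi x) ≠ 0 := by
  rw [← real_Ioi_eq_survival, measureReal_def, ENNReal.toReal_pos_iff, pos_iff_ne_zero]
  exact and_iff_left (measure_lt_top _ _)

lemma one_sub_residualDF {x y : ℝ} (hx : 0 ≤ x) (hy : F (Set.Ioi y) ≠ 0) :
    1 - residualDF F y x = survival F (x + y) / survival F y := by
  have hpos := (survival_pos_iff F y).2 hy
  have h1 : (F (Set.Ioc y (x + y))).toReal = survival F y - survival F (x + y) := by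
    have h2 : Set.Ioc y (x + y) = Set.Ioi y \ Set.Ioi (x + y) := by
      ext z
      simp
    have h3 := measureReal_sdiff (μ := F) (Set.Ioi_subset_Ioi (by linarith : y ≤ x + y))
      (measurableSet_Ioi (a := x + y))
    rw [← h2, real_Ioi_eq_survival, real_Ioi_eq_survival] at h3
    exact h3
  rw [residualDF, cond_apply measurableSet_Ioi, Set.Ioi_inter_Iic, ENNReal.toReal_mul, h1,
    ENNReal.toReal_inv, ← measureReal_def, real_Ioi_eq_survival]
  field_simp
  ring

lemma residualDF_monotone {y : ℝ} (hy : F (Set.Ioi y) ≠ 0) : Monotone (residualDF F y) := by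
  have := cond_isProbabilityMeasure hy
  exact fun a b hab => ENNReal.toReal_mono (measure_ne_top _ _)
    (measure_mono (Set.Iic_subset_Iic.2 (by linarith)))

lemma residualDF_le_one {y : ℝ} (hy : F (Set.Ioi y) ≠ 0) (x : ℝ) : residualDF F y x ≤ 1 := by
  have := cond_isProbabilityMeasure hy
  exact measureReal_le_one

lemma abs_survival_sub_le {x y : ℝ} (hx : 0 ≤ x)
    (hy : 0 ≤ y) :
    |survival F (x + y) - survival F x * survival F y| ≤ residualDeviation F * survival F y := by
  by_cases hF : F (Set.Ioi y) = 0
  · have h0 : survival F y = 0 := by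
      rw [← real_Ioi_eq_survival, measureReal_def, hF, ENNReal.toReal_zero]
    have h1 : survival F (x + y) = 0 :=
      le_antisymm (h0 ▸ survival_antitone F (by linarith)) (survival_nonneg F _)
    simp [h0, h1]
  · have hpos := (survival_pos_iff F y).2 hF
    have hle : |residualDF F y x - cdf F x| ≤ residualDeviation F := by
      refine le_csSup ⟨1, ?_⟩ ⟨x, y, hx, hy, hF, rfl⟩
      rintro d ⟨x, y, -, -, hF, rfl⟩
      have h1 := residualDF_le_one F hF x
      have h2 := residualDF_nonneg F y x
      have h3 := cdf_le_one F x
      have h4 := cdf_nonneg F x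
      exact abs_le.2 ⟨by linarith, by linarith⟩
    have h1 := one_sub_residualDF F hx hF
    have h2 : survival F (x + y) - survival F x * survival F y
        = -(residualDF F y x - cdf F x) * survival F y := by
      rw [eq_div_iff hpos.ne'] at h1
      rw [← h1]
      simp only [survival]
      ring
    rw [h2, abs_mul, abs_neg, abs_of_pos hpos]
    exact mul_le_mul_of_nonneg_right hle hpos.le

end Residual

lemma measurable_expDF (mu : ℝ) : Measurable (expDF mu) := by
  unfold expDF
  exact Measurable.ite measurableSet_Ici (by fun_prop) measurable_const

lemma expDF_nonneg {mu : ℝ} (hmu : 0 < mu) (x : ℝ) : 0 ≤ expDF mu x := by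
  unfold expDF
  split_ifs with h
  · rw [sub_nonneg, Real.exp_le_one_iff]
    nlinarith
  · exact le_rfl

lemma expDF_le_one (mu x : ℝ) : expDF mu x ≤ 1 := by
  unfold expDF
  split_ifs with h
  · exact sub_le_self _ (Real.exp_pos _).le
  · exact zero_le_one

/-- The order `C_lam` as an order between Erlang integrals of survival functions. -/
lemma LeC.integral_erlang_le {lam : ℝ} (hlam : 0 < lam) {Ξ₁ Ξ₂ : ℝ → ℝ} (h : LeC lam Ξ₁ Ξ₂)
    (hm₁ : Measurable Ξ₁) (hm₂ : Measurable Ξ₂) (h0₁ : ∀ x, 0 ≤ Ξ₁ x) (h0₂ : ∀ x, 0 ≤ Ξ₂ x)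
    (h1₁ : ∀ x, Ξ₁ x ≤ 1) (h1₂ : ∀ x, Ξ₂ x ≤ 1) (k : ℕ) :
    ∫ x in Set.Ioi 0, erlang lam k x * (1 - Ξ₁ x)
      ≤ ∫ x in Set.Ioi 0, erlang lam k x * (1 - Ξ₂ x) := by
  -- The weight in `LeC` is the Erlang density up to a positive constant. Passing from `Ξ` to `1 -
  -- Ξ` reverses the inequality.
  have key : ∀ Ξ : ℝ → ℝ, Measurable Ξ → (∀ x, 0 ≤ Ξ x) → (∀ x, Ξ x ≤ 1) →
      ∫ x in Set.Ioi 0, erlang lam k x * (1 - Ξ x) = 1 - lam ^ (k + 1) / (k.factorial : ℝ)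
        * ∫ x in Set.Ioi (0 : ℝ), Real.exp (-lam * x) * x ^ k * Ξ x := by
    intro Ξ hm h0 h1
    have hi := integrable_mul_of_mem_Icc (integrableOn_erlang hlam k) hm h0 h1
    have e : ∀ x, erlang lam k x * (1 - Ξ x) = erlang lam k x - Ξ x * erlang lam k x :=
      fun x => by ring
    simp_rw [e]
    rw [integral_sub (integrableOn_erlang hlam k) hi, integral_Ioi_erlang hlam,
      ← integral_const_mul]
    congr 2
    funext x
    unfold erlang
    rw [mul_pow]
    ring
  rw [key Ξ₁ hm₁ h0₁ h1₁, key Ξ₂ hm₂ h0₂ h1₂]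
  have hc : 0 ≤ lam ^ (k + 1) / (k.factorial : ℝ) := by positivity
  have := mul_le_mul_of_nonneg_left (h k) hc
  linarith

/-! ### Consequences of condition (A) -/

section ConditionA

variable {B F : Measure ℝ} {mu p ε : ℝ}

lemma ConditionA.cdf_zero (hA : ConditionA B F mu p ε) : cdf F 0 = 0 := by
  have h := hA.mixture 0 le_rfl
  rw [hA.service_zero] at h
  simp only [expDF, le_refl, if_true, mul_zero, Real.exp_zero, sub_self, add_zero] at h
  exact (mul_eq_zero.1 h.symm).resolve_left hA.p_pos.ne'

lemma ConditionA.survival_zero (hA : ConditionA B F mu p ε) : survival F 0 = 1 := by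
  rw [survival, hA.cdf_zero, sub_zero]

lemma ConditionA.service_nonneg [IsProbabilityMeasure B] (hA : ConditionA B F mu p ε) :
    B (Set.Iio 0) = 0 := by
  have h := hA.service_zero
  rw [cdf_eq_real, measureReal_eq_zero_iff] at h
  exact measure_mono_null Set.Iio_subset_Iic_self h

lemma ConditionA.toReal_tail_arrivalLaw [IsProbabilityMeasure B] {lam : ℝ}
    (hlam : 0 < lam) (hA : ConditionA B F mu p ε) (k : ℕ) :
    (tail (arrivalLaw lam B) (k + 1)).toReal = ∫ x in Set.Ioi 0, erlang lam k x * survival B x :=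
  (isMixedPoisson_arrivalLaw hlam B hA.service_nonneg).toReal_tail hlam hA.service_nonneg k

lemma ConditionA.survival_service (hA : ConditionA B F mu p ε) {x : ℝ} (hx : 0 ≤ x) :
    survival B x = p * survival F x + (1 - p) * Real.exp (-mu * x) := by
  rw [survival, survival, hA.mixture x hx, expDF, if_pos hx]
  ring

lemma ConditionA.almostMemoryless [IsProbabilityMeasure F] (hA : ConditionA B F mu p ε) :
    AlmostMemoryless (survival F) (1 / mu) (residualDeviation F) := by
  have hmu := hA.mu_pos
  have hint : ∫ x in Set.Ioi 0, survival F x = 1 / mu := by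
    have h0 : 0 ≤ᵐ[F] fun x : ℝ => x := by
      rw [Filter.EventuallyLE, ae_iff]
      convert! hA.nonneg using 2
      ext x
      simp
    rw [← hA.mean, hA.integrable.integral_eq_integral_meas_lt h0]
    simp_rw [← real_Ioi_eq_survival]
    rfl
  refine ⟨(survival_antitone F).antitoneOn _, fun x _ => survival_nonneg F x, ?_, hint,
    by positivity, ?_, fun x y hx hy => abs_survival_sub_le F hx hy⟩
  -- A non-integrable function would have integral `0` by convention, but the value `1 / mu` is
  -- positive.
  · by_contra h
    rw [integral_undef h] at hint
    have : 0 < 1 / mu := by positivity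
    exact this.ne hint
  · have h := (abs_nonneg _).trans (abs_survival_sub_le F (le_refl (0 : ℝ)) (le_refl (0 : ℝ)))
    rwa [hA.survival_zero, mul_one] at h

end ConditionA

/-! ### Erlang integrals of minimal residuals -/

section Minimal

variable {B F : Measure ℝ} [IsProbabilityMeasure F] {lam mu p ε y₀ : ℝ}

lemma integral_erlang_residual (lam : ℝ) (k : ℕ) {y : ℝ} (hy : F (Set.Ioi y) ≠ 0) :
    ∫ x in Set.Ioi 0, erlang lam k x * (1 - residualDF F y x)
      = (∫ x in Set.Ioi 0, erlang lam k x * survival F (x + y)) / survival F y := by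
  rw [← integral_div]
  refine setIntegral_congr_fun measurableSet_Ioi fun x hx => ?_
  rw [one_sub_residualDF F (Set.mem_Ioi.1 hx).le hy, mul_div_assoc]

lemma IsMinimalResidual.integral_erlang_le (hlam : 0 < lam) (h : IsMinimalResidual lam F y₀)
    (k : ℕ) {y : ℝ} (hy0 : 0 ≤ y) (hy : F (Set.Ioi y) ≠ 0) :
    ∫ x in Set.Ioi 0, erlang lam k x * (1 - residualDF F y₀ x)
      ≤ ∫ x in Set.Ioi 0, erlang lam k x * (1 - residualDF F y x) :=
  (h.2.2 y hy0 hy).integral_erlang_le hlam (residualDF_monotone F h.2.1).measurable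
    (residualDF_monotone F hy).measurable (residualDF_nonneg F _) (residualDF_nonneg F _)
    (residualDF_le_one F h.2.1) (residualDF_le_one F hy) k

lemma integral_erlang_zero (lam : ℝ) (f : ℝ → ℝ) :
    ∫ x in Set.Ioi 0, erlang lam 0 x * f x
      = lam * ∫ x in Set.Ioi 0, Real.exp (-lam * x) * f x := by
  rw [← integral_const_mul]
  congr 1
  funext x
  simp [erlang]
  ring

lemma integral_erlang_zero_mul_exp (hlam : 0 < lam) (hmu : 0 < mu) :
    ∫ x in Set.Ioi 0, erlang lam 0 x * Real.exp (-mu * x) = lam / (lam + mu) := by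
  have h := integral_Ioi_erlang (add_pos hlam hmu) 0
  have e : ∀ x, erlang lam 0 x * Real.exp (-mu * x) = lam / (lam + mu) * erlang (lam + mu) 0 x := by
    intro x
    have hne : lam + mu ≠ 0 := (add_pos hlam hmu).ne'
    simp only [erlang, pow_zero, mul_one, Nat.factorial_zero, Nat.cast_one, div_one]
    rw [mul_assoc, ← Real.exp_add, ← mul_assoc, div_mul_cancel₀ _ hne]
    ring_nf
  simp_rw [e]
  rw [integral_const_mul, h, mul_one]

/-- A constant below the Erlang integrals of the residuals of both components of the service
time is below those of the residuals of the service time. -/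
lemma ConditionA.mul_survival_le (hlam : 0 < lam) (hA : ConditionA B F mu p ε) {c : ℝ} {k : ℕ}
    (hF : ∀ y, 0 ≤ y → F (Set.Ioi y) ≠ 0 →
      c ≤ ∫ x in Set.Ioi 0, erlang lam k x * (1 - residualDF F y x))
    (hE : c ≤ ∫ x in Set.Ioi 0, erlang lam k x * Real.exp (-mu * x)) {y : ℝ} (hy : 0 ≤ y) :
    c * survival B y ≤ ∫ x in Set.Ioi 0, erlang lam k x * survival B (x + y) := by
  have hmu := hA.mu_pos
  have hF' : c * survival F y ≤ ∫ x in Set.Ioi 0, erlang lam k x * survival F (x + y) := by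
    by_cases h : F (Set.Ioi y) = 0
    · have h0 : survival F y = 0 := by
        rw [← real_Ioi_eq_survival, measureReal_def, h, ENNReal.toReal_zero]
      rw [h0, mul_zero]
      exact setIntegral_nonneg measurableSet_Ioi fun x hx =>
        mul_nonneg (erlang_nonneg hlam k (Set.mem_Ioi.1 hx).le) (survival_nonneg F _)
    · have h1 := hF y hy h
      rw [integral_erlang_residual lam k h, le_div_iff₀ ((survival_pos_iff F y).2 h)] at h1
      exact h1
  have hi1 : IntegrableOn (fun x => erlang lam k x * survival F (x + y)) (Set.Ioi 0) := by
    have := integrable_mul_of_mem_Icc (S := fun x => survival F (x + y))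
      (integrableOn_erlang hlam k)
      ((measurable_survival F).comp (measurable_id.add_const y)) (fun _ => survival_nonneg F _)
      fun _ => survival_le_one F _
    exact this.congr (Filter.Eventually.of_forall fun x => mul_comm _ _)
  have hi2 : IntegrableOn (fun x => erlang lam k x * Real.exp (-mu * x)) (Set.Ioi 0) := by
    refine (integrableOn_erlang hlam k).mul_bdd (c := 1)
      (Continuous.aestronglyMeasurable (by fun_prop)) ?_
    filter_upwards [self_mem_ae_restrict measurableSet_Ioi] with x hx
    rw [Real.norm_eq_abs, Real.abs_exp, Real.exp_le_one_iff]
    nlinarith [Set.mem_Ioi.1 hx]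
  -- The exponential part is memoryless: a shift by `y` only produces the factor `exp (-mu * y)`, so
  -- `hE` covers all `y` at once.
  have e : ∫ x in Set.Ioi 0, erlang lam k x * survival B (x + y)
      = p * (∫ x in Set.Ioi 0, erlang lam k x * survival F (x + y))
        + (1 - p) * Real.exp (-mu * y)
          * ∫ x in Set.Ioi 0, erlang lam k x * Real.exp (-mu * x) := by
    rw [← integral_const_mul, ← integral_const_mul,
      ← integral_add (hi1.const_mul _) (hi2.const_mul _)]
    refine setIntegral_congr_fun measurableSet_Ioi fun x hx => ?_
    rw [hA.survival_service (add_nonneg (Set.mem_Ioi.1 hx).le hy), mul_add (-mu), Real.exp_add]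
    ring
  rw [e, hA.survival_service hy]
  have h1 := mul_le_mul_of_nonneg_left hF' hA.p_pos.le
  have h2 := mul_le_mul_of_nonneg_left hE
    (mul_nonneg (sub_nonneg.2 hA.p_le_one) (Real.exp_pos (-mu * y)).le)
  linarith

/-- Minimal residuals are not much shorter than services, in terms of Laplace transforms. -/
lemma ConditionA.lt_min_residual (hlam : 0 < lam) (hA : ConditionA B F mu p ε)
    (h : IsMinimalResidual lam F y₀) :
    (1 - 5 * ε) * ∫ x in Set.Ioi 0, erlang lam 0 x * survival B x
      < min (∫ x in Set.Ioi 0, erlang lam 0 x * (1 - residualDF F y₀ x)) (lam / (lam + mu)) := by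
  have hmu := hA.mu_pos
  have hM := hA.almostMemoryless
  set S := survival F with hS
  set d := residualDeviation F with hd
  set U := ∫ x in Set.Ioi 0, Real.exp (-lam * x) * S x with hU
  have hpos : 0 < S y₀ := (survival_pos_iff F y₀).2 h.2.1
  have hshift : ∀ y : ℝ, ∫ t in Set.Ioi y, Real.exp (-lam * t) * S t
      = Real.exp (-lam * y) * ∫ x in Set.Ioi 0, Real.exp (-lam * x) * S (x + y) := by
    intro y
    rw [← integral_shift (fun t => Real.exp (-lam * t) * S t), ← integral_const_mul]
    congr 1
    funext x
    rw [mul_add, Real.exp_add, add_comm y]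
    ring
  set a := (∫ x in Set.Ioi 0, Real.exp (-lam * x) * S (x + y₀)) / S y₀ with ha
  have hres : ∀ y, F (Set.Ioi y) ≠ 0 → ∫ x in Set.Ioi 0, erlang lam 0 x * (1 - residualDF F y x)
      = lam * ((∫ x in Set.Ioi 0, Real.exp (-lam * x) * S (x + y)) / S y) := by
    intro y hy
    rw [integral_erlang_residual lam 0 hy, integral_erlang_zero lam fun x => survival F (x + y),
      mul_div_assoc]
  have ha0 : 0 ≤ a := div_nonneg (setIntegral_nonneg measurableSet_Ioi fun x _ =>
    mul_nonneg (Real.exp_pos _).le (survival_nonneg F _)) hpos.le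
  have hmin : ∀ y, 0 ≤ y → a * (Real.exp (-lam * y) * S y)
      ≤ ∫ t in Set.Ioi y, Real.exp (-lam * t) * S t := by
    intro y hy
    rw [hshift, mul_left_comm]
    refine mul_le_mul_of_nonneg_left ?_ (Real.exp_pos _).le
    by_cases hF : F (Set.Ioi y) = 0
    · have h0 : S y = 0 := by
        rw [hS, ← real_Ioi_eq_survival, measureReal_def, hF, ENNReal.toReal_zero]
      rw [h0, mul_zero]
      exact setIntegral_nonneg measurableSet_Ioi fun x _ =>
        mul_nonneg (Real.exp_pos _).le (survival_nonneg F _)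
    · have h1 := h.integral_erlang_le hlam 0 hy hF
      rw [hres y₀ h.2.1, hres y hF] at h1
      have h2 := le_of_mul_le_mul_left h1 hlam
      rwa [← ha, le_div_iff₀ ((survival_pos_iff F y).2 hF)] at h2
  have heq : ∫ t in Set.Ioi y₀, Real.exp (-lam * t) * S t
      = a * (Real.exp (-lam * y₀) * S y₀) := by
    rw [hshift, mul_left_comm, ha, div_mul_cancel₀ _ hpos.ne']
  have hUpos : 0 < U := hM.integral_damped_pos hlam
  -- Since `B` mixes `F` with an exponential, the minimal residual is compared with both components:
  -- with `U`, where the damped `S` is almost memoryless with mean `U`, and with `E`.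
  have h1 : (1 - 5 * d) * U ≤ a := (hM.damped hlam).le_of_minimal ha0 h.1
    (mul_pos (Real.exp_pos _) hpos) hmin heq
  have h2 := hM.le_damped_of_minimal hlam ha0 h.1 hpos hmin heq
  have h3 := hM.damped_integral_le hlam
  have hd0 : 0 ≤ d := hM.dev_nonneg
  have hdε : d < ε := hA.close
  set E := 1 / (lam + mu) with hE
  have hEpos : 0 < E := by positivity
  have hEm : (1 / mu) = E * (1 + lam * (1 / mu)) := by
    rw [hE]
    field_simp
    ring
  have hw : 0 < 1 + lam * (1 / mu) := by positivity
  have h2' : (1 - 5 * d) * E ≤ a := by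
    refine le_of_mul_le_mul_right ?_ hw
    rw [mul_assoc, ← hEm]
    exact h2
  have h3' : U ≤ E * (1 + d) := by
    refine le_of_mul_le_mul_right ?_ hw
    calc U * (1 + lam * (1 / mu)) ≤ 1 / mu * (1 + d) := h3
      _ = E * (1 + d) * (1 + lam * (1 / mu)) := by
        nth_rewrite 1 [hEm]
        ring
  -- For `d < 1/5` this is `(1 - 5 d)(1 + d) = 1 - 4 d - 5 d ^ 2 ≤ 1`; otherwise the left side is
  -- nonpositive.
  have h4 : (1 - 5 * d) * U ≤ E := by
    rcases le_or_gt (1 - 5 * d) 0 with hneg | hnn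
    · exact (mul_nonpos_of_nonpos_of_nonneg hneg hUpos.le).trans hEpos.le
    · calc (1 - 5 * d) * U ≤ (1 - 5 * d) * (E * (1 + d)) := by gcongr
        _ = E - E * (4 * d + 5 * d * d) := by ring
        _ ≤ E := sub_le_self _ (by positivity)
  have h5 : (1 - 5 * d) * E ≤ E := by
    have := mul_nonneg hd0 hEpos.le
    linarith
  have hp0 := hA.p_pos
  have hp1 := hA.p_le_one
  have hY : ∫ x in Set.Ioi 0, erlang lam 0 x * survival B x
      = lam * (p * U + (1 - p) * E) := by
    have hi1 := (hM.integrableOn_damped hlam).const_mul p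
    have hi2 : IntegrableOn (fun x => (1 - p) * (Real.exp (-lam * x) * Real.exp (-mu * x)))
        (Set.Ioi 0) := by
      have := (integrableOn_exp_mul_Ioi (by linarith : -(lam + mu) < 0) 0).const_mul (1 - p)
      refine this.congr (Filter.Eventually.of_forall fun x => ?_)
      simp only
      rw [← Real.exp_add]
      ring_nf
    have hexp : ∫ x in Set.Ioi 0, Real.exp (-lam * x) * Real.exp (-mu * x) = E := by
      have := integral_erlang_zero_mul_exp hlam hmu
      rw [integral_erlang_zero, div_eq_mul_one_div] at this
      exact mul_left_cancel₀ hlam.ne' this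
    rw [integral_erlang_zero, ← hexp, hU, ← integral_const_mul p, ← integral_const_mul (1 - p),
      ← integral_add hi1 hi2]
    congr 1
    refine setIntegral_congr_fun measurableSet_Ioi fun x hx => ?_
    rw [hA.survival_service (Set.mem_Ioi.1 hx).le]
    ring
  set Y := p * U + (1 - p) * E with hYdef
  have hYpos : 0 < Y := add_pos_of_pos_of_nonneg (mul_pos hp0 hUpos)
    (mul_nonneg (sub_nonneg.2 hp1) hEpos.le)
  have hmix : ∀ b, (1 - 5 * d) * U ≤ b → (1 - 5 * d) * E ≤ b → (1 - 5 * ε) * (lam * Y) < lam * b :=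
    fun b hb1 hb2 => by
      have h6 := mul_le_mul_of_nonneg_left hb1 hp0.le
      have h7 := mul_le_mul_of_nonneg_left hb2 (sub_nonneg.2 hp1)
      have h8 : (1 - 5 * d) * Y ≤ b := by
        rw [hYdef]
        linarith
      have h9 : (1 - 5 * ε) * Y < (1 - 5 * d) * Y := mul_lt_mul_of_pos_right (by linarith) hYpos
      have h10 := mul_lt_mul_of_pos_left (h9.trans_le h8) hlam
      linarith
  rw [hY, hres y₀ h.2.1, div_eq_mul_one_div lam, lt_min_iff]
  exact ⟨hmix a h1 h2', hmix E h4 h5⟩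

variable [IsProbabilityMeasure B]

/-- Tail inequality for the number of arrivals during a service. -/
lemma ConditionA.mul_tail_le (hlam : 0 < lam) (hA : ConditionA B F mu p ε) {c : ℝ} {j : ℕ}
    (hF : ∀ y, 0 ≤ y → F (Set.Ioi y) ≠ 0 →
      c ≤ ∫ x in Set.Ioi 0, erlang lam j x * (1 - residualDF F y x))
    (hE : c ≤ ∫ x in Set.Ioi 0, erlang lam j x * Real.exp (-mu * x)) (k : ℕ) :
    c * (tail (arrivalLaw lam B) k).toReal
      ≤ (tail (arrivalLaw lam B) (k + (j + 1))).toReal := by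
  cases k with
  | zero =>
    have h := hA.mul_survival_le hlam hF hE (le_refl (0 : ℝ))
    have h0 : survival B 0 = 1 := by rw [survival, hA.service_zero, sub_zero]
    rw [zero_add, hA.toReal_tail_arrivalLaw hlam, tail_zero, ENNReal.toReal_one]
    simpa [h0] using h
  | succ k =>
    rw [show k + 1 + (j + 1) = k + j + 1 + 1 by ring, hA.toReal_tail_arrivalLaw hlam,
      hA.toReal_tail_arrivalLaw hlam]
    exact mul_integral_erlang_le hlam (measurable_survival B) (survival_nonneg B)
      (survival_le_one B) (fun y hy => hA.mul_survival_le hlam hF hE hy.le) k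

end Minimal

/-! ### The offspring law -/

/-- Geometric law with success probability `b`. -/
noncomputable def geometricLaw {b c : ℝ≥0∞} (h : b + c = 1) (hb : b ≠ 0) : PMF ℕ :=
  ⟨fun k => c ^ k * b, by
    have hc : c ≠ ∞ := fun hc => by simp [hc] at h
    have hb' : b ≠ ∞ := fun hb => by simp [hb] at h
    have h1 : 1 - c = b := ENNReal.sub_eq_of_eq_add hc h.symm
    rw [ENNReal.summable.hasSum_iff, ENNReal.tsum_mul_right, ENNReal.tsum_geometric, h1,
      ENNReal.inv_mul_cancel hb hb']⟩

/-- The law with mass `r` at `0` and mass `t * g k` at `k + 1`. -/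
noncomputable def zeroModified (g : PMF ℕ) {r t : ℝ≥0∞} (h : r + t = 1) : PMF ℕ :=
  ⟨fun k => Nat.casesOn k r fun k => t * g k, by
    rw [ENNReal.summable.hasSum_iff, tsum_eq_zero_add' ENNReal.summable, ENNReal.tsum_mul_left,
      g.tsum_coe, mul_one]
    exact h⟩

lemma pgf_zeroModified_geometricLaw {b c r t : ℝ≥0∞} (h : b + c = 1) (hb : b ≠ 0)
    (hrt : r + t = 1) {z : ℝ} (hz : |z| ≤ 1) :
    pgf (zeroModified (geometricLaw h hb) hrt) z
      = r.toReal + t.toReal * (z * b.toReal / (1 - z + z * b.toReal)) := by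
  have hbtop : b ≠ ∞ := fun hb => by simp [hb] at h
  have hctop : c ≠ ∞ := fun hc => by simp [hc] at h
  have hsum : b.toReal + c.toReal = 1 := by
    rw [← ENNReal.toReal_add hbtop hctop, h, ENNReal.toReal_one]
  have hbpos : 0 < b.toReal := ENNReal.toReal_pos hb hbtop
  have hlt : ‖c.toReal * z‖ < 1 := by
    rw [Real.norm_eq_abs, abs_mul, abs_of_nonneg ENNReal.toReal_nonneg]
    calc c.toReal * |z| ≤ c.toReal * 1 := by gcongr
      _ < 1 := by linarith
  have hterm : ∀ k, ((zeroModified (geometricLaw h hb) hrt) (k + 1)).toReal * z ^ (k + 1)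
      = t.toReal * (z * b.toReal) * (c.toReal * z) ^ k := by
    intro k
    have : (zeroModified (geometricLaw h hb) hrt) (k + 1) = t * (c ^ k * b) := rfl
    rw [this, ENNReal.toReal_mul, ENNReal.toReal_mul, ENNReal.toReal_pow, mul_pow, pow_succ]
    ring
  have hs := (summable_geometric_of_norm_lt_one hlt).mul_left (t.toReal * (z * b.toReal))
  have hs' : Summable fun k => ((zeroModified (geometricLaw h hb) hrt) k).toReal * z ^ k := by
    rw [← summable_nat_add_iff 1]
    exact hs.congr fun k => (hterm k).symm
  have hden : 1 - c.toReal * z = 1 - z + z * b.toReal := by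
    have hc : c.toReal = 1 - b.toReal := by linarith
    rw [hc]
    ring
  rw [pgf, hs'.tsum_eq_zero_add]
  simp_rw [hterm]
  rw [tsum_mul_left, tsum_geometric_of_norm_lt_one hlt, hden, pow_zero, mul_one,
    div_eq_mul_inv]
  have : (zeroModified (geometricLaw h hb) hrt) 0 = r := rfl
  rw [this]
  ring

/-- Over the common denominator the claim is `(1 - β - t)(1 - z) < 5 ε (1 - z + 2 z β)`. Here `1 - β
- t < 5 ε (1 - β)`, and `1 - z + 2 z β` exceeds `(1 - β)(1 - z)` by `β (1 + z)`. The first estimate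
is strict unless `z = 1`, where the second is. -/
lemma pgf_bound {β t ε z : ℝ} (hβ0 : 0 < β) (hβ1 : β < 1) (hε : 0 < ε)
    (ht : (1 - 5 * ε) * (1 - β) < t) (hz : |z| ≤ 1) :
    (1 - t) + t * (z * β / (1 - z + z * β))
      < β / (1 - z + z * β) + 5 * ε * ((1 - z + 2 * z * β) / (1 - z + z * β)) := by
  obtain ⟨hz0, hz1⟩ := abs_le.1 hz
  have hD : 0 < 1 - z + z * β := by nlinarith
  have e1 : (1 - t) + t * (z * β / (1 - z + z * β))
      = (β + (1 - β - t) * (1 - z)) / (1 - z + z * β) := by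
    field_simp
    ring
  have e2 : β / (1 - z + z * β) + 5 * ε * ((1 - z + 2 * z * β) / (1 - z + z * β))
      = (β + 5 * ε * (1 - z + 2 * z * β)) / (1 - z + z * β) := by
    field_simp
  rw [e1, e2]
  refine div_lt_div_of_pos_right ?_ hD
  have h1 : 0 ≤ (t - (1 - 5 * ε) * (1 - β)) * (1 - z) := mul_nonneg (by linarith) (by linarith)
  have h2 : 0 ≤ ε * β * (1 + z) := by
    have : 0 ≤ 1 + z := by linarith
    positivity
  rcases hz1.lt_or_eq with hlt | rfl
  · have h3 : 0 < (t - (1 - 5 * ε) * (1 - β)) * (1 - z) := mul_pos (by linarith) (by linarith)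
    nlinarith
  · have : 0 < ε * β := by positivity
    nlinarith

/-- Laws of the losses of an excursion: sums over Galton–Watson generations, started with
geometrically many copies. -/
noncomputable def excursionLaw (g q s : PMF ℕ) : ℕ → PMF ℕ
  | 0 => s
  | m + 1 => randomSum g ((randomSum q)^[m] s)

/-! ### Domination of the branching sum by the losses -/

section Domination

variable {π s : PMF ℕ} {b c r t : ℝ≥0∞}

lemma expect_randomSum_iterate (h : b + c = 1) (hb : b ≠ 0) (hrt : r + t = 1) (m : ℕ)
    (f : ℕ → ℝ≥0∞) :
    expect ((randomSum (zeroModified (geometricLaw h hb) hrt))^[m + 1] s) f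
      = r * f 0 + t * expect (excursionLaw (geometricLaw h hb)
          (zeroModified (geometricLaw h hb) hrt) s (m + 1)) fun x =>
        expect ((randomSum (zeroModified (geometricLaw h hb) hrt))^[m] s) fun y => f (x + y) := by
  rw [Function.iterate_succ_apply']
  exact expect_randomSum_zero_modified (g := geometricLaw h hb) rfl (fun _ => rfl) _ f

/-- Lack of memory of the geometric law: given at least one summand, the number of further summands
has the same law. -/
lemma expect_excursionLaw_succ (h : b + c = 1) (hb : b ≠ 0) (q : PMF ℕ) (m : ℕ)
    (f : ℕ → ℝ≥0∞) :
    expect (excursionLaw (geometricLaw h hb) q s (m + 1)) f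
      = b * f 0 + c * expect (excursionLaw (geometricLaw h hb) q s (m + 1)) fun x =>
        expect ((randomSum q)^[m] s) fun y => f (x + y) := by
  refine expect_randomSum_zero_modified (g := geometricLaw h hb) ?_ (fun k => ?_) _ f
  · show c ^ 0 * b = b
    rw [pow_zero, one_mul]
  · show c ^ (k + 1) * b = c * (c ^ k * b)
    rw [pow_succ']
    exact mul_assoc _ _ _

/-- Both laws mix the same two terms, the larger one with weight `t` on the left and `c ≥ t` on the
right. A fresh service is at least as productive as the bound for an interrupted one. -/
lemma expect_randomSum_iterate_le (h : b + c = 1) (hb : b ≠ 0) (hrt : r + t = 1) (htc : t ≤ c)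
    {f : ℕ → ℝ≥0∞} (hf : Monotone f) (n : ℕ) :
    expect ((randomSum (zeroModified (geometricLaw h hb) hrt))^[n] s) f
      ≤ expect (excursionLaw (geometricLaw h hb) (zeroModified (geometricLaw h hb) hrt) s n) f := by
  cases n with
  | zero => exact le_rfl
  | succ m =>
    rw [expect_randomSum_iterate, expect_excursionLaw_succ _ _ _ _ f]
    have hp : t * (b + c) ≤ c := by rwa [h, mul_one]
    refine le_of_eq_of_le ?_ (convex_step hrt hp ?_)
    · rw [h, one_mul]
    · calc f 0 = expect (excursionLaw (geometricLaw h hb) (zeroModified (geometricLaw h hb) hrt)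
            s (m + 1)) fun _ => f 0 := (expect_const _ _).symm
        _ ≤ _ := expect_mono _ fun x => by
          rw [← expect_const ((randomSum (zeroModified (geometricLaw h hb) hrt))^[m] s) (f 0)]
          exact expect_mono _ fun y => hf (Nat.zero_le _)

lemma monotone_indicator_le (k : ℕ) : Monotone fun x : ℕ => if k ≤ x then (1 : ℝ≥0∞) else 0 := by
  intro x y hxy
  dsimp only
  split_ifs
  · exact le_rfl
  · omega
  · exact zero_le
  · exact le_rfl

lemma stochDominates_losses {Ω : Type*} [MeasurableSpace Ω] {P : Measure Ω}
    [IsProbabilityMeasure P] {lam : ℝ} {B : Measure ℝ} [IsProbabilityMeasure B]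
    {N : ℝ≥0 → Ω → ℕ} {χ : ℕ → Ω → ℝ≥0} (hQ : IsMGIInput P lam B N χ)
    (hπ : arrivalLaw lam B 0 = b) (h : b + c = 1) (hb : b ≠ 0) (hrt : r + t = 1)
    (ht : ∀ k, t * tail (arrivalLaw lam B) k ≤ tail (arrivalLaw lam B) (k + 1))
    (hst : ∀ k m, tail (arrivalLaw lam B) k * tail s m ≤ tail (arrivalLaw lam B) (k + m))
    (n : ℕ) :
    StochDominates P (losses n N χ)
      (randomSum (galtonWatson (zeroModified (geometricLaw h hb) hrt) n) s) := by
  intro k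
  have htc : t ≤ c := by
    have h1 := ht 0
    have h2 := tail_succ (arrivalLaw lam B) 0
    rw [tail_zero, hπ, ← h, zero_add] at h2
    have hbt : b ≠ ∞ := by rw [← hπ]; exact PMF.apply_ne_top _ 0
    rw [tail_zero, mul_one, zero_add, ← (ENNReal.add_right_inj hbt).1 h2] at h1
    exact h1
  rw [← expect_indicator, randomSum_galtonWatson]
  refine (expect_randomSum_iterate_le h hb hrt htc (monotone_indicator_le k) n).trans ?_
  rw [expect_indicator]
  obtain ⟨hi, hlaw⟩ := arrivalsIn_iid hQ
  exact expect_le_measure_losses (fun j => measurable_arrivalsIn hQ j) hi hlaw (hπ ▸ hb) n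
    (fun m f hf => expect_le_excursion hrt hπ h ht hst rfl rfl
      (fun m f => expect_randomSum_iterate h hb hrt m f)
      (fun m f => expect_excursionLaw_succ h hb _ m f) m hf) k

end Domination

/-! ### Parameters of the offspring law in terms of the service time -/

section Parameters

variable {B F : Measure ℝ} [IsProbabilityMeasure B] [IsProbabilityMeasure F] {lam mu p ε : ℝ}

lemma laplace_eq_one_sub (hlam : 0 < lam) (hF : F (Set.Iio 0) = 0) :
    laplace F lam = 1 - ∫ x in Set.Ioi 0, erlang lam 0 x * survival F x := by
  have h := one_sub_sum_mixedPoisson hlam F hF 0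
  simp only [zero_add, Finset.range_one, Finset.sum_singleton, pow_zero, mul_one,
    Nat.factorial_zero, Nat.cast_one, div_one] at h
  simp only [laplace, survival]
  linarith

lemma laplace_pos (hlam : 0 < lam) (hF : F (Set.Iio 0) = 0) : 0 < laplace F lam := by
  have hnn : ∀ᵐ x ∂F, (0 : ℝ) ≤ x := by
    rw [ae_iff]
    convert! hF using 2
    ext x
    simp
  have hres : F.restrict (Set.Ici 0) = F := Measure.restrict_eq_self_of_ae_mem hnn
  rw [laplace, hres]
  refine integral_exp_pos (Integrable.of_bound (C := 1) (by fun_prop) ?_)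
  filter_upwards [hnn] with x hx
  rw [Real.norm_eq_abs, Real.abs_exp, Real.exp_le_one_iff]
  nlinarith

lemma ConditionA.toReal_arrivalLaw_zero (hlam : 0 < lam) (hA : ConditionA B F mu p ε) :
    (arrivalLaw lam B 0).toReal = p * laplace F lam + (1 - p) * (mu / (mu + lam)) := by
  have hmu := hA.mu_pos
  have h1 := toReal_tail_eq_one_sub (arrivalLaw lam B) 1
  have h2 := hA.toReal_tail_arrivalLaw hlam 0
  have h3 : ∫ x in Set.Ioi 0, erlang lam 0 x * survival B x
      = p * (∫ x in Set.Ioi 0, erlang lam 0 x * survival F x)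
        + (1 - p) * ∫ x in Set.Ioi 0, erlang lam 0 x * Real.exp (-mu * x) := by
    have hi1 := integrable_mul_of_mem_Icc (integrableOn_erlang hlam 0) (measurable_survival F)
      (survival_nonneg F) (survival_le_one F)
    have hi2 : IntegrableOn (fun x => erlang lam 0 x * Real.exp (-mu * x)) (Set.Ioi 0) := by
      by_contra hn
      have h := integral_erlang_zero_mul_exp hlam hmu
      rw [integral_undef hn] at h
      have : 0 < lam / (lam + mu) := by positivity
      linarith
    rw [← integral_const_mul, ← integral_const_mul, ← integral_add
      ((hi1.congr (Filter.Eventually.of_forall fun x => mul_comm _ _)).const_mul _)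
      (hi2.const_mul _)]
    refine setIntegral_congr_fun measurableSet_Ioi fun x hx => ?_
    rw [hA.survival_service (Set.mem_Ioi.1 hx).le]
    ring
  rw [integral_erlang_zero_mul_exp hlam hmu] at h3
  have h4 := laplace_eq_one_sub hlam hA.nonneg
  have h5 : mu / (mu + lam) = 1 - lam / (lam + mu) := by
    have : lam + mu ≠ 0 := (add_pos hlam hmu).ne'
    rw [add_comm mu lam]
    field_simp
    ring
  rw [Finset.sum_range_one] at h1
  rw [zero_add] at h2
  rw [h4, h5]
  linear_combination h1 - h2 - h3

lemma ConditionA.mul_tail_le_of_residual (hlam : 0 < lam) (hA : ConditionA B F mu p ε)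
    {y₀ : ℝ} (hy : IsMinimalResidual lam F y₀) {a : ℝ≥0∞} (ha : a ≠ ∞) {j : ℕ}
    (hF : a.toReal ≤ ∫ x in Set.Ioi 0, erlang lam j x * (1 - residualDF F y₀ x))
    (hE : a.toReal ≤ ∫ x in Set.Ioi 0, erlang lam j x * Real.exp (-mu * x)) (k : ℕ) :
    a * tail (arrivalLaw lam B) k ≤ tail (arrivalLaw lam B) (k + (j + 1)) := by
  have hfin : ∀ k, tail (arrivalLaw lam B) k ≠ ∞ := fun k =>
    ((tail_le_one _ k).trans_lt ENNReal.one_lt_top).ne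
  rw [← ENNReal.toReal_le_toReal (ENNReal.mul_ne_top ha (hfin k)) (hfin _), ENNReal.toReal_mul]
  exact hA.mul_tail_le hlam
    (fun y hy0 hy1 => hF.trans (hy.integral_erlang_le hlam j hy0 hy1)) hE k

end Parameters

end LossQueue

theorem theorem2p4 {Ω : Type*} [MeasurableSpace Ω] (P : Measure Ω) [IsProbabilityMeasure P]
    (n : ℕ) (lam mu p ε : ℝ) (hlam : 0 < lam)
    (B F : Measure ℝ) [IsProbabilityMeasure B] [IsProbabilityMeasure F]
    (N : ℝ≥0 → Ω → ℕ) (χ : ℕ → Ω → ℝ≥0)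
    (hQ : LossQueue.IsMGIInput P lam B N χ)
    (hA : LossQueue.ConditionA B F mu p ε)
    (hD : LossQueue.ConditionD lam F)
    (β : ℝ) (hβ : β = p * LossQueue.laplace F lam + (1 - p) * (mu / (mu + lam))) :
    ∃ q : PMF ℕ,
      (∀ z : ℝ, |z| ≤ 1 →
        LossQueue.pgf q z <
          β / (1 - z + z * β) + 5 * ε * ((1 - z + 2 * z * β) / (1 - z + z * β))) ∧
      ∀ (y0 : ℝ), LossQueue.IsMinimalResidual lam F y0 →
        ∀ (G : Measure ℝ) [IsProbabilityMeasure G], G (Set.Iio 0) = 0 →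
          LossQueue.LeC lam (cdf G) (LossQueue.residualDF F y0) →
          LossQueue.LeC lam (cdf G) (LossQueue.expDF mu) →
          ∀ s : PMF ℕ, LossQueue.IsMixedPoisson lam G s →
            LossQueue.StochDominates P (LossQueue.losses n N χ)
              (LossQueue.randomSum (LossQueue.galtonWatson q n) s) := by
  obtain ⟨y₀, hy₀⟩ := hD
  have hmu := hA.mu_pos
  set π := LossQueue.arrivalLaw lam B with hπ
  have hπ0 := hA.toReal_arrivalLaw_zero hlam
  rw [← hβ] at hπ0
  have hβ0 : 0 < β := by
    have h1 := mul_pos hA.p_pos (LossQueue.laplace_pos hlam hA.nonneg)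
    have h2 : 0 ≤ (1 - p) * (mu / (mu + lam)) :=
      mul_nonneg (sub_nonneg.2 hA.p_le_one) (by positivity)
    linarith
  have hbc : π 0 + LossQueue.tail π 1 = 1 := by
    rw [← LossQueue.tail_zero π, LossQueue.tail_succ π 0]
  have hb : π 0 ≠ 0 := fun h => by
    rw [h, ENNReal.toReal_zero] at hπ0
    exact hβ0.ne hπ0
  -- Lower bound for the probability of an arrival in any residual service: the first entry covers
  -- the residuals of `ζ`, the second the exponential component. It becomes the mass `t` of the
  -- offspring law away from `0`.
  set τ := min (∫ x in Set.Ioi 0, LossQueue.erlang lam 0 x * (1 - LossQueue.residualDF F y₀ x))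
    (lam / (lam + mu)) with hτ
  have hτ0 : 0 ≤ τ := le_min (setIntegral_nonneg measurableSet_Ioi fun x hx => mul_nonneg
    (LossQueue.erlang_nonneg hlam 0 (Set.mem_Ioi.1 hx).le)
    (sub_nonneg.2 (LossQueue.residualDF_le_one F hy₀.2.1 x))) (by positivity)
  have hτreal : (ENNReal.ofReal τ).toReal = τ := ENNReal.toReal_ofReal hτ0
  have ht : ∀ k, ENNReal.ofReal τ * LossQueue.tail π k ≤ LossQueue.tail π (k + 1) :=
    hA.mul_tail_le_of_residual hlam hy₀ ENNReal.ofReal_ne_top (j := 0)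
      (hτreal.trans_le (min_le_left _ _))
      (by rw [hτreal, LossQueue.integral_erlang_zero_mul_exp hlam hmu]; exact min_le_right _ _)
  have hone : (LossQueue.tail π 1).toReal = 1 - β := by
    rw [LossQueue.toReal_tail_eq_one_sub, Finset.sum_range_one, hπ0]
  have htail : ENNReal.ofReal τ ≤ LossQueue.tail π 1 := by
    have := ht 0
    rwa [LossQueue.tail_zero, mul_one] at this
  have hrt : (1 - ENNReal.ofReal τ) + ENNReal.ofReal τ = 1 :=
    tsub_add_cancel_of_le (htail.trans (LossQueue.tail_le_one π 1))
  have hlt : (1 - 5 * ε) * (1 - β) < τ := by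
    have := hA.lt_min_residual hlam hy₀
    rwa [← hA.toReal_tail_arrivalLaw hlam, zero_add, hone] at this
  have hτle : τ ≤ 1 - β := by
    rw [← hτreal, ← hone]
    exact ENNReal.toReal_mono ((LossQueue.tail_le_one π 1).trans_lt ENNReal.one_lt_top).ne htail
  -- `0 ≤ τ ≤ 1 - β` gives `β ≤ 1`; equality would make the strict inequality `hlt` read `0 < τ`,
  -- against `τ ≤ 0`.
  have hβ1 : β < 1 := by
    by_contra h
    have h0 : 1 - β = 0 := by linarith
    rw [h0, mul_zero] at hlt
    linarith
  have hr : (1 - ENNReal.ofReal τ).toReal = 1 - τ := by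
    rw [ENNReal.toReal_sub_of_le (htail.trans (LossQueue.tail_le_one π 1)) ENNReal.one_ne_top,
      hτreal, ENNReal.toReal_one]
  refine ⟨LossQueue.zeroModified (LossQueue.geometricLaw hbc hb) hrt, fun z hz => ?_, ?_⟩
  · rw [LossQueue.pgf_zeroModified_geometricLaw hbc hb hrt hz, hr, hτreal, hπ0]
    exact LossQueue.pgf_bound hβ0 hβ1 hA.ε_pos hlt hz
  · intro y0 hy0 G _ hG hGF hGE s hs
    -- The offspring law was built from the particular minimizer `y₀`. The given `y0` enters only
    -- through the tail bound for `s`, for which any minimizer serves.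
    refine LossQueue.stochDominates_losses hQ rfl hbc hb hrt ht (fun k m => ?_) n
    cases m with
    | zero => rw [LossQueue.tail_zero, mul_one, add_zero]
    | succ j =>
      have hcdf := (monotone_cdf G).measurable
      rw [mul_comm]
      refine hA.mul_tail_le_of_residual hlam hy0
        ((LossQueue.tail_le_one s _).trans_lt ENNReal.one_lt_top).ne ?_ ?_ k
      · rw [hs.toReal_tail hlam hG]
        exact hGF.integral_erlang_le hlam hcdf
          (LossQueue.residualDF_monotone F hy0.2.1).measurable (cdf_nonneg G)
          (LossQueue.residualDF_nonneg F y0) (cdf_le_one G)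
          (LossQueue.residualDF_le_one F hy0.2.1) j
      · rw [hs.toReal_tail hlam hG]
        refine (hGE.integral_erlang_le hlam hcdf (LossQueue.measurable_expDF mu) (cdf_nonneg G)
          (LossQueue.expDF_nonneg hmu) (cdf_le_one G) (LossQueue.expDF_le_one mu) j).trans_eq ?_
        refine setIntegral_congr_fun measurableSet_Ioi fun x hx => ?_
        rw [LossQueue.expDF, if_pos (Set.mem_Ioi.1 hx).le, sub_sub_cancel]
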